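/- Theorem 1.4. For $n\ge 1$ let $\nu_n$ be a probability distribution on $\mathbb{R}^n$ that is invariant under rotations (orthogonal transformations) and satisfies $\nu_n(\{0\})=0$. Assume that there are a deterministic sequence of nonzero reals $(a_n)_{n\ge1}$ and constants $d_1,d_2,\alpha>0$, $\rho_0\in(0,1)$ such that for every $n\ge1$ and every $\rho\in(0,\rho_0)$ $$\nu_n\left(\left\{x:\left|\frac{\|x\|^2}{a_n}-1\right|\ge\rho\right\}\right)\le d_1e^{-n d_2\rho^\alpha}.$$ Let $0\le g(n)\le n$ be integers (for constant $g$ consider $n\ge g$), and for each $n$ let $b_1^{(n)},\dots,b_{n-g(n)}^{(n)}$ be independent random vectors of $\mathbb{R}^n$ with common distribution $\nu_n$. Write $p=n-g(n)$, and let $\widehat b_1^{(n)},\dots,\widehat b_p^{(n)}$ be the (non-normalized) Gram--Schmidt orthogonalization of $b_1^{(n)},\dots,b_p^{(n)}$. For $s\in(0,1)$ the system is called $s$-reduced if it is linearly independent and $\|\widehat b_{i+1}^{(n)}\|^2/\|\widehat b_i^{(n)}\|^2>s^2$ for all $1\le i\le p-1$. If $p\ge2$, put $$\mathcal{M}_n^g=\min_{1\le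 i\le p-1}\frac{\|\widehat b_{i+1}^{(n)}\|^2}{\|\widehat b_i^{(n)}\|^2},\qquad \mathcal{I}_n^g=\min\left\{i : \frac{\|\widehat b_{n-i}^{(n)}\|^2}{\|\widehat b_{n-i-1}^{(n)}\|^2}=\mathcal{M}_n^g\right\},$$ where $i$ in the second formula ranges over $g\le i\le n-2$ (for $p\le1$ put $\mathcal{I}_n^g=0$). Let $s\in(0,1)$. (i) If $g(n)\to\infty$, then the probability that $(b_1^{(n)},\dots,b_{n-g(n)}^{(n)})$ is $s$-reduced tends to $1$ as $n\to\infty$. (ii) If $g(n)=g$ is constant, then the probability that $(b_1^{(n)},\dots,b_{n-g}^{(n)})$ is $s$-reduced converges, as $n\to\infty$, to a constant in $(0,1)$ that depends only on $s$ and $g$. (iii) If $g(n)=g$ is constant, then $\mathcal{I}_n^g$ converges in distribution, as $n\to\infty$, to a probability law on the nonnegative integers that depends only on $g$. -/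

import Mathlib

open Filter Topology MeasureTheory ProbabilityTheory

universe u

/-- A spherical model: for each dimension `n ≥ 1`, a probability distribution `ν n` on `ℝⁿ`
which is invariant under rotations (all linear isometries of `ℝⁿ`, i.e. the orthogonal group)
and does not charge the origin. -/
structure IsSphericalModel (ν : (n : ℕ) → Measure (EuclideanSpace ℝ (Fin n))) : Prop where
  isProbabilityMeasure : ∀ n, 1 ≤ n → IsProbabilityMeasure (ν n)
  map_rotation : ∀ n, 1 ≤ n →
    ∀ f : EuclideanSpace ℝ (Fin n) ≃ₗᵢ[ℝ] EuclideanSpace ℝ (Fin n), (ν n).map f = ν n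
  zero : ∀ n, 1 ≤ n → ν n {0} = 0

/-- The concentration assumption on the squared norm of a vector with distribution `ν n`. -/
def RadialConcentration (ν : (n : ℕ) → Measure (EuclideanSpace ℝ (Fin n))) : Prop :=
  ∃ (a : ℕ → ℝ) (d₁ d₂ α ρ₀ : ℝ), (∀ n, 1 ≤ n → a n ≠ 0) ∧
    0 < d₁ ∧ 0 < d₂ ∧ 0 < α ∧ ρ₀ ∈ Set.Ioo (0 : ℝ) 1 ∧
    ∀ n, 1 ≤ n → ∀ ρ ∈ Set.Ioo (0 : ℝ) ρ₀,
      (ν n).real {x | ρ ≤ |‖x‖ ^ 2 / a n - 1|} ≤ d₁ * Real.exp (-(n * d₂ * ρ ^ α))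

/-- `b 0, …, b (p - 1)` are independent random vectors with common distribution `ν`. -/
structure IsRandomBasis {n p : ℕ} {Ω : Type*} [MeasurableSpace Ω] (P : Measure Ω)
    (ν : Measure (EuclideanSpace ℝ (Fin n))) (b : Fin p → Ω → EuclideanSpace ℝ (Fin n)) :
    Prop where
  indep : iIndepFun b P
  hasLaw : ∀ i, HasLaw (b i) ν P

/-- The ratio `‖b̂_{j+2}‖² / ‖b̂_{j+1}‖²` of squared lengths of consecutive Gram–Schmidt vectors,
where the system is written `b_1, …, b_p` (so that `b_{j+1}` is `b j` in Lean's numbering). -/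
noncomputable def localRatio {n p : ℕ} (b : Fin p → EuclideanSpace ℝ (Fin n))
    (j : Fin (p - 1)) : ℝ :=
  ‖InnerProductSpace.gramSchmidt ℝ b ⟨j + 1, by omega⟩‖ ^ 2 /
    ‖InnerProductSpace.gramSchmidt ℝ b ⟨j, by omega⟩‖ ^ 2

/-- LLL(`s`)-reduced (in the sense of Siegel): the system is linearly independent and all ratios
of squared lengths of consecutive Gram–Schmidt vectors exceed `s²`. -/
def IsSiegelReduced {n p : ℕ} (s : ℝ) (b : Fin p → EuclideanSpace ℝ (Fin n)) : Prop :=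
  LinearIndependent ℝ b ∧ ∀ j : Fin (p - 1), s ^ 2 < localRatio b j

/-- The reduction level: the minimum of the `p - 1` local ratios
(a finite infimum; only meaningful for `2 ≤ p`). -/
noncomputable def reductionLevel {n p : ℕ} (b : Fin p → EuclideanSpace ℝ (Fin n)) : ℝ :=
  ⨅ j : Fin (p - 1), localRatio b j

/-- The index of worst local reduction: the least `i` such that
`‖b̂_{n-i}‖² / ‖b̂_{n-i-1}‖²` equals the reduction level. In the zero-based numbering of
`localRatio` this ratio is number `j = n - i - 2`. (Equal to `0` if `p ≤ 1`.) -/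
noncomputable def worstIndex {n p : ℕ} (b : Fin p → EuclideanSpace ℝ (Fin n)) : ℕ :=
  sInf {i : ℕ | ∃ j : Fin (p - 1), (j : ℕ) + i + 2 = n ∧ localRatio b j = reductionLevel b}

/-!
Multiply each vector of the random system by the ratio of the length of an independent Gaussian
vector to its own length. By rotation invariance the new vectors are independent Gaussian vectors,
so in `ℝⁿ` the squared norms of their Gram–Schmidt vectors are independent, the `j`-th one
(counted from `0`) having a chi-squared law with `n - j` degrees of freedom. By radial concentration
all the scaling factors are nearly equal, so that, up to factors close to `1`, the local ratios of
the system are the ratios `η (i + 1) / η (i + 2)`, read from the end, of a sequence of independent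
`η k ~ χ²(k)` which does not depend on the dimension.

As `η k / k → 1` almost surely, these ratios tend to `1`, while infinitely often they are less than
`1`. Hence only finitely many of them matter, both for being `s`-reduced and for the position of the
least ratio; and as their laws have no atoms, both are almost surely unchanged when the ratios are
multiplied by factors close enough to `1`.
-/

section ProductMeasure

variable {α : Type*} [MeasurableSpace α]

theorem measurePreserving_snoc {p : ℕ} (μ : Fin (p + 1) → Measure α) [∀ i, SigmaFinite (μ i)] :
    MeasurePreserving (fun q : (Fin p → α) × α => (Fin.snoc q.1 q.2 : Fin (p + 1) → α))
      ((Measure.pi fun i : Fin p => μ i.castSucc).prod (μ (Fin.last p))) (Measure.pi μ) := by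
  have h := (measurePreserving_piFinSuccAbove μ (Fin.last p)).symm.comp
    (Measure.measurePreserving_swap
      (μ := Measure.pi fun i : Fin p => μ ((Fin.last p).succAbove i)) (ν := μ (Fin.last p)))
  simp only [Fin.succAbove_last] at h
  convert! h using 1
  ext q : 1
  simp [MeasurableEquiv.piFinSuccAbove, Fin.insertNthEquiv, Fin.insertNth_last']

variable {ι κ : Type*} (μ : κ → Measure α) [∀ i, IsProbabilityMeasure (μ i)]

theorem measurable_extend {e : ι → κ} (he : Function.Injective e) :
    Measurable fun q : (ι → α) × (κ → α) => Function.extend e q.1 q.2 := by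
  refine measurable_pi_lambda _ fun k => ?_
  by_cases hk : ∃ i, e i = k
  · obtain ⟨i, rfl⟩ := hk
    simp only [he.extend_apply]
    fun_prop
  · simp only [Function.extend_apply' _ _ _ hk]
    fun_prop

theorem measurePreserving_extend {e : ι → κ} (he : Function.Injective e) :
    MeasurePreserving (fun q : (ι → α) × (κ → α) => Function.extend e q.1 q.2)
      ((Measure.infinitePi fun i => μ (e i)).prod (Measure.infinitePi μ))
      (Measure.infinitePi μ) := by
  classical
  refine ⟨measurable_extend he, Measure.eq_infinitePi _ fun s t ht => ?_⟩
  have hpre : (fun q : (ι → α) × (κ → α) => Function.extend e q.1 q.2) ⁻¹' Set.pi s t =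
      Set.pi (s.preimage e he.injOn) (fun i => t (e i)) ×ˢ
        Set.pi (s.filter (· ∉ Set.range e)) t := by
    ext q
    simp only [Set.mem_preimage, Set.mem_pi, Finset.mem_coe, Set.mem_prod, Finset.mem_preimage,
      Finset.mem_filter, Set.mem_range]
    refine ⟨fun h => ⟨fun i hi => by simpa [he.extend_apply] using h _ hi,
      fun k hk => by simpa [Function.extend_apply' _ _ _ hk.2] using h _ hk.1⟩, ?_⟩
    rintro ⟨hι, hκ⟩ k hk
    by_cases hke : ∃ i, e i = k
    · obtain ⟨i, rfl⟩ := hke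
      simpa [he.extend_apply] using hι i hk
    · simpa [Function.extend_apply' _ _ _ hke] using hκ k ⟨hk, hke⟩
  rw [Measure.map_apply (measurable_extend he) (.pi s.countable_toSet fun i _ => ht i), hpre,
    Measure.prod_prod, Measure.infinitePi_pi _ fun i _ => ht (e i),
    Measure.infinitePi_pi _ fun i _ => ht i,
    Finset.prod_preimage' e s he.injOn fun k => μ k (t k),
    Finset.prod_filter_mul_prod_filter_not]

theorem ae_infinitePi_apply_ne [DecidableEq κ] [MeasurableEq α] (i : κ)
    [NullSingletonClass (μ i)] {f : (κ → α) → α} (hf : Measurable f)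
    (hfi : ∀ η x, f (Function.update η i x) = f η) :
    ∀ᵐ η ∂Measure.infinitePi μ, η i ≠ f η := by
  have he : Function.Injective (fun _ : Unit => i) := Function.injective_of_subsingleton _
  have hupdate (x : Unit → α) (η : κ → α) :
      Function.extend (fun _ => i) x η = Function.update η i (x ()) := by
    ext k
    by_cases hk : k = i
    · subst hk
      simpa using he.extend_apply x η ()
    · simpa [hk] using Function.extend_apply' (f := fun _ : Unit => i) x η k (by simp [Ne.symm hk])
  have hmeas : MeasurableSet {η : κ → α | η i ≠ f η} :=
    (measurableSet_eq_fun (measurable_pi_apply i) hf).compl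
  rw [← (measurePreserving_extend μ he).map_eq,
    ae_map_iff (measurable_extend he).aemeasurable hmeas]
  have hpre : MeasurableSet {q : (Unit → α) × (κ → α) |
      Function.extend (fun _ => i) q.1 q.2 i ≠ f (Function.extend (fun _ => i) q.1 q.2)} :=
    measurable_extend he hmeas
  rw [Measure.ae_prod_iff_ae_ae hpre, Measure.ae_ae_comm hpre]
  refine ae_of_all _ fun η => ?_
  have h := (measurePreserving_eval_infinitePi (fun _ : Unit => μ i) ()).quasiMeasurePreserving.ae
    (measure_eq_zero_iff_ae_notMem.1 (measure_singleton (f η)))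
  filter_upwards [h] with x hx
  simpa [hupdate, hfi] using hx

end ProductMeasure

section GramSchmidt

open InnerProductSpace

variable {ι E : Type*} [NormedAddCommGroup E] [InnerProductSpace ℝ E]
  [LinearOrder ι] [LocallyFiniteOrderBot ι] [WellFoundedLT ι]

theorem gramSchmidt_smul (f : ι → E) {c : ι → ℝ} (hc : ∀ i, c i ≠ 0) (i : ι) :
    gramSchmidt ℝ (fun i => c i • f i) i = c i • gramSchmidt ℝ f i := by
  induction i using WellFoundedLT.induction with
  | ind i ih =>
    rw [gramSchmidt_def, gramSchmidt_def ℝ f, smul_sub, Finset.smul_sum]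
    congr 1
    refine Finset.sum_congr rfl fun j hj => ?_
    have hspan : ℝ ∙ gramSchmidt ℝ (fun i => c i • f i) j = ℝ ∙ gramSchmidt ℝ f j := by
      rw [ih j (Finset.mem_Iio.1 hj), Submodule.span_singleton_smul_eq (hc j).isUnit]
    simp only [hspan, map_smul]

theorem linearIndependent_of_gramSchmidt_ne_zero [Finite ι] {f : ι → E}
    (h : ∀ i, gramSchmidt ℝ f i ≠ 0) : LinearIndependent ℝ f := by
  have := Fintype.ofFinite ι
  have hgs : LinearIndependent ℝ (gramSchmidt ℝ f) :=
    linearIndependent_of_ne_zero_of_inner_eq_zero h (gramSchmidt_pairwise_orthogonal ℝ f)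
  rw [linearIndependent_iff_card_eq_finrank_span] at hgs ⊢
  rw [hgs, Set.finrank, Set.finrank, span_gramSchmidt]

/-- The squared norms of the (non-normalized) Gram–Schmidt vectors of a family. -/
noncomputable def gsNormSq (f : ι → E) (i : ι) : ℝ := ‖gramSchmidt ℝ f i‖ ^ 2

theorem gsNormSq_smul (f : ι → E) {c : ι → ℝ} (hc : ∀ i, c i ≠ 0) (i : ι) :
    gsNormSq (fun i => c i • f i) i = c i ^ 2 * gsNormSq f i := by
  rw [gsNormSq, gramSchmidt_smul f hc, norm_smul, mul_pow, Real.norm_eq_abs, sq_abs, gsNormSq]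

theorem linearIndependent_iff_forall_gsNormSq_ne_zero [Finite ι] {f : ι → E} :
    LinearIndependent ℝ f ↔ ∀ i, gsNormSq f i ≠ 0 := by
  simp only [gsNormSq, ne_eq, OfNat.ofNat_ne_zero, not_false_eq_true, pow_eq_zero_iff,
    norm_eq_zero]
  exact ⟨fun h i => gramSchmidt_ne_zero i h, linearIndependent_of_gramSchmidt_ne_zero⟩

variable [FiniteDimensional ℝ E]

theorem gramSchmidt_eq_starProjection (f : ι → E) (i : ι) :
    gramSchmidt ℝ f i = (Submodule.span ℝ (f '' Set.Iio i))ᗮ.starProjection (f i) := by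
  have horth : ℝ ∙ gramSchmidt ℝ f i ⟂ Submodule.span ℝ (gramSchmidt ℝ f '' Set.Iio i) := by
    rw [Submodule.isOrtho_span]
    rintro _ rfl _ ⟨j, hj, rfl⟩
    exact gramSchmidt_orthogonal ℝ f (ne_of_gt hj)
  rw [← span_gramSchmidt_Iio ℝ f i]
  refine (Submodule.eq_starProjection_of_mem_orthogonal
    (horth (Submodule.mem_span_singleton_self _)) ?_).symm
  rw [Submodule.orthogonal_orthogonal, gramSchmidt_def ℝ f i, sub_sub_cancel]
  refine Submodule.sum_mem _ fun j hj => ?_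
  have hmem : gramSchmidt ℝ f j ∈ gramSchmidt ℝ f '' Set.Iio i := ⟨j, Finset.mem_Iio.1 hj, rfl⟩
  exact Submodule.span_mono (Set.singleton_subset_iff.2 hmem)
    (Submodule.starProjection_apply_mem (ℝ ∙ gramSchmidt ℝ f j) (f i))

theorem gramSchmidt_snoc_castSucc {p : ℕ} (y : Fin p → E) (z : E) (j : Fin p) :
    gramSchmidt ℝ (Fin.snoc y z : Fin (p + 1) → E) j.castSucc = gramSchmidt ℝ y j := by
  rw [gramSchmidt_eq_starProjection, gramSchmidt_eq_starProjection, Fin.snoc_castSucc]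
  have himage : (Fin.snoc y z : Fin (p + 1) → E) '' Set.Iio j.castSucc = y '' Set.Iio j := by
    rw [← Fin.image_castSucc_Iio, Set.image_image]
    simp only [Fin.snoc_castSucc]
  simp only [himage]

theorem gramSchmidt_snoc_last {p : ℕ} (y : Fin p → E) (z : E) :
    gramSchmidt ℝ (Fin.snoc y z : Fin (p + 1) → E) (Fin.last p) =
      (Submodule.span ℝ (Set.range y))ᗮ.starProjection z := by
  rw [gramSchmidt_eq_starProjection, Fin.snoc_last]
  have himage : (Fin.snoc y z : Fin (p + 1) → E) '' Set.Iio (Fin.last p) = Set.range y := by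
    have hIio : Set.Iio (Fin.last p) = Set.range Fin.castSucc := by
      rw [Fin.range_castSucc]
      rfl
    rw [hIio, ← Set.range_comp]
    exact congrArg Set.range (Fin.snoc_comp_castSucc)
  simp only [himage]

variable [MeasurableSpace E] [BorelSpace E]

theorem measurable_gramSchmidt (i : ι) : Measurable fun f : ι → E => gramSchmidt ℝ f i := by
  induction i using WellFoundedLT.induction with
  | ind i ih =>
    have h : (fun f : ι → E => gramSchmidt ℝ f i) = fun f => f i - ∑ j ∈ Finset.Iio i,
        (inner ℝ (gramSchmidt ℝ f j) (f i) / ‖gramSchmidt ℝ f j‖ ^ 2) • gramSchmidt ℝ f j := by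
      ext1 f
      rw [gramSchmidt_def]
      simp only [Submodule.starProjection_singleton]
      rfl
    rw [h]
    refine (measurable_pi_apply i).sub (Finset.measurable_sum _ fun j hj => ?_)
    have hj' := ih j (Finset.mem_Iio.1 hj)
    exact ((hj'.inner (measurable_pi_apply i)).div (hj'.norm.pow_const 2)).smul hj'

theorem measurable_gsNormSq : Measurable (gsNormSq : (ι → E) → ι → ℝ) :=
  measurable_pi_lambda _ fun i => (measurable_gramSchmidt i).norm.pow_const 2

end GramSchmidt

/-- The chi-squared distribution with `k` degrees of freedom: the law of the squared norm of a
standard Gaussian vector of `ℝᵏ`. -/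
noncomputable def chiSq (k : ℕ) : Measure ℝ :=
  (stdGaussian (EuclideanSpace ℝ (Fin k))).map fun x => ‖x‖ ^ 2

section ChiSquared

instance isProbabilityMeasure_chiSq (k : ℕ) : IsProbabilityMeasure (chiSq k) :=
  Measure.isProbabilityMeasure_map (by fun_prop)

theorem chiSq_eq_map_pi (k : ℕ) :
    chiSq k = (Measure.pi fun _ : Fin k => gaussianReal 0 1).map fun x => ∑ i, x i ^ 2 := by
  rw [chiSq, ← map_pi_eq_stdGaussian, Measure.map_map (by fun_prop) (by fun_prop)]
  simp only [Function.comp_def, EuclideanSpace.real_norm_sq_eq]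

instance nullSingletonClass_chiSq (k : ℕ) [NeZero k] : NullSingletonClass (chiSq k) where
  measure_singleton c := by
    have : NullSingletonClass (gaussianReal 0 1) := nullSingletonClass_gaussianReal one_ne_zero
    have hupdate (x : Fin k → ℝ) (t : ℝ) : ∑ i ∈ Finset.univ.erase 0, Function.update x 0 t i ^ 2 =
        ∑ i ∈ Finset.univ.erase 0, x i ^ 2 :=
      Finset.sum_congr rfl fun i hi => by rw [Function.update_of_ne (Finset.ne_of_mem_erase hi)]
    have hsqrt := ae_infinitePi_apply_ne (fun _ : Fin k => gaussianReal 0 1) 0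
      (f := fun x => √(c - ∑ i ∈ Finset.univ.erase 0, x i ^ 2)) (by fun_prop) (by simp [hupdate])
    have hneg_sqrt := ae_infinitePi_apply_ne (fun _ : Fin k => gaussianReal 0 1) 0
      (f := fun x => -√(c - ∑ i ∈ Finset.univ.erase 0, x i ^ 2)) (by fun_prop) (by simp [hupdate])
    rw [chiSq_eq_map_pi, ← Measure.infinitePi_eq_pi, measure_eq_zero_iff_ae_notMem, ae_map_iff
      (f := fun x : Fin k → ℝ => ∑ i, x i ^ 2) (Measurable.aemeasurable (by fun_prop))
      (measurableSet_singleton c).compl]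
    filter_upwards [hsqrt, hneg_sqrt] with x hx hx' hsum
    rw [Set.mem_singleton_iff, ← Finset.add_sum_erase _ _ (Finset.mem_univ 0)] at hsum
    rw [← eq_sub_iff_add_eq.2 hsum, Real.sqrt_sq_eq_abs] at hx hx'
    rcases abs_choice (x 0) with h | h <;> simp [h] at hx hx'

instance isOpenPosMeasure_stdGaussian (k : ℕ) :
    (stdGaussian (EuclideanSpace ℝ (Fin k))).IsOpenPosMeasure := by
  have : (gaussianReal 0 1).IsOpenPosMeasure :=
    (gaussianReal_absolutelyContinuous' 0 one_ne_zero).isOpenPosMeasure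
  rw [← map_pi_eq_stdGaussian]
  exact Continuous.isOpenPosMeasure_map (by fun_prop) (WithLp.toLp_surjective 2)

theorem chiSq_pos_of_isOpen {k : ℕ} [NeZero k] {U : Set ℝ} (hU : IsOpen U) {x : ℝ} (hx : 0 ≤ x)
    (hxU : x ∈ U) : 0 < chiSq k U := by
  rw [chiSq, Measure.map_apply (by fun_prop) hU.measurableSet]
  refine (hU.preimage (by fun_prop)).measure_pos _ ⟨√x • EuclideanSpace.single 0 1, ?_⟩
  simpa [norm_smul, Real.sq_sqrt hx] using hxU

theorem ae_chiSq_pos (k : ℕ) [NeZero k] : ∀ᵐ x ∂chiSq k, 0 < x := by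
  have hnonneg : ∀ᵐ x ∂chiSq k, 0 ≤ x := by
    rw [chiSq, ae_map_iff (by fun_prop) measurableSet_Ici]
    exact ae_of_all _ fun x => sq_nonneg _
  filter_upwards [hnonneg, Measure.ae_ne (chiSq k) 0] with x hx hx0
  exact hx.lt_of_ne' hx0

variable {E : Type*} [NormedAddCommGroup E] [InnerProductSpace ℝ E] [FiniteDimensional ℝ E]
  [MeasurableSpace E] [BorelSpace E]

theorem map_norm_sq_stdGaussian :
    (stdGaussian E).map (fun x => ‖x‖ ^ 2) = chiSq (Module.finrank ℝ E) := by
  have e := (stdOrthonormalBasis ℝ E).repr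
  rw [chiSq, ← stdGaussian_map e, Measure.map_map (by fun_prop) e.continuous.measurable]
  simp only [Function.comp_def, LinearIsometryEquiv.norm_map]

theorem map_orthogonalProjectionOnto_stdGaussian (K : Submodule ℝ E) :
    (stdGaussian E).map K.orthogonalProjectionOnto = stdGaussian K := by
  have : IsProbabilityMeasure ((stdGaussian E).map K.orthogonalProjectionOnto) :=
    Measure.isProbabilityMeasure_map (by fun_prop)
  refine Measure.ext_of_charFun (funext fun t => ?_)
  have h := charFun_stdGaussian (t : E)
  rw [charFun_apply] at h
  rw [charFun_stdGaussian, charFun_apply, integral_map (by fun_prop) (by fun_prop)]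
  simpa using h

theorem map_norm_sq_starProjection_stdGaussian (K : Submodule ℝ E) :
    (stdGaussian E).map (fun x => ‖K.starProjection x‖ ^ 2) = chiSq (Module.finrank ℝ K) := by
  rw [← map_norm_sq_stdGaussian, ← map_orthogonalProjectionOnto_stdGaussian K,
    Measure.map_map (by fun_prop) (by fun_prop)]
  rfl

theorem map_gsNormSq_snoc_last_stdGaussian {p : ℕ} {y : Fin p → E} (hy : LinearIndependent ℝ y) :
    (stdGaussian E).map (fun z => gsNormSq (Fin.snoc y z : Fin (p + 1) → E) (Fin.last p)) =
      chiSq (Module.finrank ℝ E - p) := by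
  simp only [gsNormSq, gramSchmidt_snoc_last]
  rw [map_norm_sq_starProjection_stdGaussian]
  have hspan := finrank_span_eq_card hy
  have horth := (Submodule.span ℝ (Set.range y)).finrank_add_finrank_orthogonal
  rw [hspan, Fintype.card_fin] at horth
  congr 1
  omega

theorem ae_forall_pi_chiSq_ne_zero {n p : ℕ} (hp : p ≤ n) :
    ∀ᵐ x ∂Measure.pi fun j : Fin p => chiSq (n - j), ∀ j, x j ≠ 0 := by
  refine ae_all_iff.2 fun j => ?_
  have : NeZero (n - j) := ⟨by omega⟩
  exact (measurePreserving_eval (fun j : Fin p => chiSq (n - j)) j).quasiMeasurePreserving.ae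
    (Measure.ae_ne _ 0)

theorem measurePreserving_gsNormSq_stdGaussian {p : ℕ} (hp : p ≤ Module.finrank ℝ E) :
    MeasurePreserving gsNormSq (Measure.pi fun _ : Fin p => stdGaussian E)
      (Measure.pi fun j : Fin p => chiSq (Module.finrank ℝ E - j)) := by
  induction p with
  | zero =>
    refine ⟨measurable_gsNormSq, ?_⟩
    rw [Measure.pi_of_empty, Measure.pi_of_empty, Measure.map_dirac' measurable_gsNormSq]
    congr 1
    exact Subsingleton.elim _ _
  | succ p ih =>
    have ih := ih (by omega)
    have hsnoc := measurePreserving_snoc fun _ : Fin (p + 1) => stdGaussian E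
    have hsnoc' := measurePreserving_snoc fun j : Fin (p + 1) => chiSq (Module.finrank ℝ E - j)
    have hindep : ∀ᵐ y ∂Measure.pi fun _ : Fin p => stdGaussian E, LinearIndependent ℝ y := by
      simp only [linearIndependent_iff_forall_gsNormSq_ne_zero]
      exact ih.quasiMeasurePreserving.ae (ae_forall_pi_chiSq_ne_zero (by omega))
    have hskew := ih.skew_product (μc := stdGaussian E) (μd := chiSq (Module.finrank ℝ E - p))
      (g := fun y z => gsNormSq (Fin.snoc y z : Fin (p + 1) → E) (Fin.last p))
      (((measurable_pi_apply _).comp measurable_gsNormSq).comp hsnoc.measurable)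
      (by filter_upwards [hindep] with y hy using map_gsNormSq_snoc_last_stdGaussian hy)
    refine ⟨measurable_gsNormSq, ?_⟩
    rw [← (hsnoc'.comp hskew).map_eq, ← hsnoc.map_eq,
      Measure.map_map measurable_gsNormSq hsnoc.measurable]
    congr 1
    ext q j
    induction j using Fin.lastCases with
    | last => simp
    | cast j => simp [gsNormSq, gramSchmidt_snoc_castSucc]

end ChiSquared

section CramerChernoff

variable {Ω : Type*} [MeasurableSpace Ω] {μ : Measure Ω} [IsProbabilityMeasure μ] {X : Ω → ℝ}

theorem exists_pos_exp_mul_mgf_lt_one (hX : 0 ∈ interior (integrableExpSet X μ)) {c : ℝ}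
    (hc : μ[X] < c) :
    ∃ t > 0, t ∈ integrableExpSet X μ ∧ Real.exp (-t * c) * mgf X μ t < 1 := by
  have hderiv : HasDerivAt (fun t => Real.exp (-t * c) * mgf X μ t) (μ[X] - c) 0 := by
    convert! ((hasDerivAt_neg (0 : ℝ)).mul_const c).exp.mul (hasDerivAt_mgf hX) using 1
    simp [sub_eq_neg_add]
  have hslope := (hasDerivAt_iff_tendsto_slope.1 hderiv).eventually_lt_const (sub_neg.2 hc)
  have hint := eventually_nhdsWithin_of_eventually_nhds (s := Set.Ioi 0)
    (isOpen_interior.mem_nhds hX)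
  obtain ⟨t, ht, hneg, ht0⟩ :=
    (hint.and ((hslope.filter_mono (nhdsWithin_mono 0 fun t ht => ne_of_gt ht)).and
      self_mem_nhdsWithin)).exists
  refine ⟨t, ht0, interior_subset ht, ?_⟩
  have hneg := (slope_neg_iff_of_le (le_of_lt ht0)).1 hneg
  simpa using hneg

theorem exists_lt_one_forall_pi_measureReal_le_sum_le_pow (hXm : Measurable X)
    (hX : 0 ∈ interior (integrableExpSet X μ)) {c : ℝ} (hc : μ[X] < c) :
    ∃ q, 0 ≤ q ∧ q < 1 ∧ ∀ k : ℕ,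
      (Measure.pi fun _ : Fin k => μ).real {ω | k * c ≤ ∑ i, X (ω i)} ≤ q ^ k := by
  obtain ⟨t, ht, hint, hlt⟩ := exists_pos_exp_mul_mgf_lt_one hX hc
  refine ⟨_, by positivity [mgf_nonneg (X := X) (μ := μ) (t := t)], hlt, fun k => ?_⟩
  set P := Measure.pi fun _ : Fin k => μ
  have hindep : iIndepFun (fun (i : Fin k) ω => X (ω i)) P := iIndepFun_pi fun _ => hXm.aemeasurable
  have heval (i : Fin k) : MeasurePreserving (Function.eval i) P μ := measurePreserving_eval _ i
  have hmgf (i : Fin k) : mgf (fun ω => X (ω i)) P t = mgf X μ t := by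
    rw [← (heval i).map_eq, mgf_map (heval i).aemeasurable (by fun_prop)]
    rfl
  calc P.real {ω | k * c ≤ ∑ i, X (ω i)}
      = P.real {ω | k * c ≤ (∑ i, fun ω : Fin k → Ω => X (ω i)) ω} := by
        simp only [Finset.sum_apply]
    _ ≤ Real.exp (-t * (k * c)) * mgf (∑ i, fun ω : Fin k → Ω => X (ω i)) P t :=
        measure_ge_le_exp_mul_mgf _ ht.le (hindep.integrable_exp_mul_sum
          (fun i => by fun_prop) fun i _ => (heval i).integrable_comp_of_integrable hint)
    _ = (Real.exp (-t * c) * mgf X μ t) ^ k := by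
        rw [hindep.mgf_sum fun i => by fun_prop]
        simp only [hmgf, Finset.prod_const, Finset.card_univ, Fintype.card_fin]
        rw [mul_pow, ← Real.exp_nat_mul]
        ring_nf

theorem exists_lt_one_forall_pi_measureReal_abs_sum_sub_le (hXm : Measurable X)
    (hX : 0 ∈ interior (integrableExpSet X μ)) {ρ : ℝ} (hρ : 0 < ρ) :
    ∃ q, 0 ≤ q ∧ q < 1 ∧ ∀ k : ℕ, (Measure.pi fun _ : Fin k => μ).real
      {ω | k * ρ ≤ |∑ i, X (ω i) - k * μ[X]|} ≤ 2 * q ^ k := by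
  have hnegX : 0 ∈ interior (integrableExpSet (-X) μ) := by
    have hpre : integrableExpSet (-X) μ = Neg.neg ⁻¹' integrableExpSet X μ := by
      ext t
      simp [integrableExpSet]
    rw [hpre]
    exact preimage_interior_subset_interior_preimage continuous_neg (by simpa using hX)
  obtain ⟨q₁, hq₁0, hq₁, h₁⟩ := exists_lt_one_forall_pi_measureReal_le_sum_le_pow hXm hX
    (lt_add_of_pos_right μ[X] hρ)
  obtain ⟨q₂, hq₂0, hq₂, h₂⟩ := exists_lt_one_forall_pi_measureReal_le_sum_le_pow hXm.neg hnegX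
    (lt_add_of_pos_right μ[-X] hρ)
  refine ⟨max q₁ q₂, le_max_of_le_left hq₁0, max_lt hq₁ hq₂, fun k => ?_⟩
  calc (Measure.pi fun _ : Fin k => μ).real {ω | k * ρ ≤ |∑ i, X (ω i) - k * μ[X]|}
      ≤ (Measure.pi fun _ : Fin k => μ).real ({ω | k * (μ[X] + ρ) ≤ ∑ i, X (ω i)} ∪
          {ω | k * (μ[-X] + ρ) ≤ ∑ i, (-X) (ω i)}) := by
        refine measureReal_mono fun ω hω => ?_
        simp only [Pi.neg_apply, integral_neg, Finset.sum_neg_distrib, Set.mem_union,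
          Set.mem_ofPred_eq] at hω ⊢
        rcases le_abs'.1 hω with h | h
        · right; linarith
        · left; linarith
    _ ≤ q₁ ^ k + q₂ ^ k := (measureReal_union_le _ _).trans (add_le_add (h₁ k) (h₂ k))
    _ ≤ 2 * max q₁ q₂ ^ k := by
        rw [two_mul]
        gcongr
        exacts [le_max_left _ _, le_max_right _ _]

end CramerChernoff

section ChiSquaredConcentration

theorem integrable_exp_mul_sq_gaussianReal {t : ℝ} (ht : t < 1 / 2) :
    Integrable (fun x => Real.exp (t * x ^ 2)) (gaussianReal 0 1) := by
  rw [gaussianReal_of_var_ne_zero 0 one_ne_zero,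
    integrable_withDensity_iff (measurable_gaussianPDF 0 1)
      (ae_of_all _ fun x => gaussianPDF_lt_top)]
  convert! (integrable_exp_neg_mul_sq (b := 1 / 2 - t) (by linarith)).const_mul
    (√(2 * Real.pi))⁻¹ using 1
  ext x
  rw [toReal_gaussianPDF, gaussianPDFReal, mul_left_comm, ← Real.exp_add]
  simp only [NNReal.coe_one, mul_one]
  ring_nf

theorem zero_mem_interior_integrableExpSet_sq_gaussianReal :
    0 ∈ interior (integrableExpSet (fun x => x ^ 2) (gaussianReal 0 1)) :=
  mem_interior.2 ⟨Set.Iio (1 / 2), fun _ ht => integrable_exp_mul_sq_gaussianReal ht, isOpen_Iio,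
    by norm_num⟩

theorem integral_sq_gaussianReal : ∫ x, x ^ 2 ∂gaussianReal 0 1 = 1 := by
  have h := variance_eq_integral (μ := gaussianReal 0 1) (X := id) aemeasurable_id
  simpa [variance_id_gaussianReal, integral_id_gaussianReal] using h.symm

theorem exists_lt_one_forall_chiSq_measureReal_le {ρ : ℝ} (hρ : 0 < ρ) :
    ∃ q, 0 ≤ q ∧ q < 1 ∧ ∀ k : ℕ, (chiSq k).real {x | k * ρ ≤ |x - k|} ≤ 2 * q ^ k := by
  obtain ⟨q, hq0, hq1, hq⟩ := exists_lt_one_forall_pi_measureReal_abs_sum_sub_le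
    (μ := gaussianReal 0 1) (by fun_prop) zero_mem_interior_integrableExpSet_sq_gaussianReal hρ
  refine ⟨q, hq0, hq1, fun k => ?_⟩
  rw [chiSq_eq_map_pi, map_measureReal_apply (by fun_prop)
    (measurableSet_le (by fun_prop) (by fun_prop))]
  simpa [integral_sq_gaussianReal] using hq k

end ChiSquaredConcentration

/-- The law of a sequence `η` of independent random variables, `η k` being chi-squared distributed
with `k` degrees of freedom. -/
noncomputable def chiSqSeq : Measure (ℕ → ℝ) := Measure.infinitePi chiSq

instance isProbabilityMeasure_chiSqSeq : IsProbabilityMeasure chiSqSeq :=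
  inferInstanceAs (IsProbabilityMeasure (Measure.infinitePi chiSq))

/-- The ratios of consecutive entries of a sequence, read from the beginning. Under `chiSqSeq`,
`limitRatio η i` is the limit of `‖b̂_{n-i}‖² / ‖b̂_{n-i-1}‖²`. -/
noncomputable def limitRatio (η : ℕ → ℝ) (i : ℕ) : ℝ := η (i + 1) / η (i + 2)

section LimitRatio

theorem measurable_limitRatio (i : ℕ) : Measurable fun η => limitRatio η i :=
  (measurable_pi_apply _).div (measurable_pi_apply _)

theorem measurePreserving_eval_chiSqSeq (k : ℕ) :
    MeasurePreserving (Function.eval k) chiSqSeq (chiSq k) :=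
  measurePreserving_eval_infinitePi chiSq k

theorem ae_chiSqSeq_pos : ∀ᵐ η ∂chiSqSeq, ∀ k, 0 < η (k + 1) :=
  ae_all_iff.2 fun k => (measurePreserving_eval_chiSqSeq (k + 1)).quasiMeasurePreserving.ae
    (ae_chiSq_pos (k + 1))

theorem ae_chiSqSeq_eventually_abs_sub_lt {ρ : ℝ} (hρ : 0 < ρ) :
    ∀ᵐ η ∂chiSqSeq, ∀ᶠ k : ℕ in atTop, |η k - (k : ℝ)| < k * ρ := by
  obtain ⟨q, hq0, hq1, hq⟩ := exists_lt_one_forall_chiSq_measureReal_le hρ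
  have hle (k : ℕ) : chiSqSeq {η | k * ρ ≤ |η k - (k : ℝ)|} ≤ ENNReal.ofReal (2 * q ^ k) := by
    have hpre := (measurePreserving_eval_chiSqSeq k).measure_preimage
      (measurableSet_le (f := fun _ => k * ρ) (g := fun x : ℝ => |x - k|)
        (by fun_prop) (by fun_prop)).nullMeasurableSet
    calc chiSqSeq {η | k * ρ ≤ |η k - (k : ℝ)|} = chiSq k {x | k * ρ ≤ |x - k|} := hpre
      _ ≤ ENNReal.ofReal (2 * q ^ k) := by
        rw [← ofReal_measureReal]
        exact ENNReal.ofReal_le_ofReal (hq k)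
  have hsum : ∑' k : ℕ, chiSqSeq {η | k * ρ ≤ |η k - (k : ℝ)|} ≠ ⊤ :=
    ne_top_of_le_ne_top ((summable_geometric_of_lt_one hq0 hq1).mul_left 2).tsum_ofReal_ne_top
      (ENNReal.tsum_le_tsum hle)
  filter_upwards [ae_eventually_notMem hsum] with η hη
  filter_upwards [hη] with k hk using not_le.1 hk

theorem ae_chiSqSeq_tendsto_div :
    ∀ᵐ η ∂chiSqSeq, Tendsto (fun k : ℕ => η k / (k : ℝ)) atTop (𝓝 1) := by
  have h (m : ℕ) := ae_chiSqSeq_eventually_abs_sub_lt (Nat.one_div_pos_of_nat (α := ℝ) (n := m))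
  filter_upwards [ae_all_iff.2 h] with η hη
  refine Metric.tendsto_nhds.2 fun ε hε => ?_
  obtain ⟨m, hm⟩ := exists_nat_one_div_lt hε
  filter_upwards [hη m, eventually_gt_atTop 0] with k hk hk0
  have hk0 : (0 : ℝ) < k := Nat.cast_pos.2 hk0
  rw [Real.dist_eq, div_sub_one hk0.ne', abs_div, Nat.abs_cast, div_lt_iff₀' hk0]
  exact hk.trans (by gcongr)

theorem ae_tendsto_limitRatio : ∀ᵐ η ∂chiSqSeq, Tendsto (limitRatio η) atTop (𝓝 1) := by
  filter_upwards [ae_chiSqSeq_tendsto_div] with η hη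
  have hnum := (tendsto_add_atTop_iff_nat 1).2 hη
  have hden := (tendsto_add_atTop_iff_nat 2).2 hη
  have hindex := (tendsto_add_atTop_iff_nat 1).2 (tendsto_natCast_div_add_atTop (1 : ℝ))
  have h := (hnum.div hden one_ne_zero).mul hindex
  rw [div_one, mul_one] at h
  refine h.congr fun i => ?_
  simp only [limitRatio, Pi.div_apply]
  push_cast
  field_simp
  ring

theorem ae_exists_ge_limitRatio_lt_one (g : ℕ) : ∀ᵐ η ∂chiSqSeq, ∃ i ≥ g, limitRatio η i < 1 := by
  filter_upwards [ae_chiSqSeq_tendsto_div, ae_chiSqSeq_pos] with η hη hpos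
  by_contra! hge
  have hanti (k : ℕ) : η (g + k + 1) ≤ η (g + 1) := by
    induction k with
    | zero => rfl
    | succ k ih => exact ((one_le_div (hpos _)).1 (hge (g + k) (by omega))).trans ih
  have hzero : Tendsto (fun k : ℕ => η (g + 1) / (k : ℝ)) atTop (𝓝 0) :=
    tendsto_const_div_atTop_nhds_zero_nat _
  refine absurd (le_of_tendsto_of_tendsto hη hzero ?_) (not_le.2 one_pos)
  filter_upwards [eventually_gt_atTop g] with k hk
  obtain ⟨m, rfl⟩ := Nat.exists_eq_add_of_lt hk
  gcongr
  exact hanti m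

theorem ae_limitRatio_ne (i : ℕ) (c : ℝ) : ∀ᵐ η ∂chiSqSeq, limitRatio η i ≠ c := by
  filter_upwards [ae_infinitePi_apply_ne chiSq (i + 1) (f := fun η => c * η (i + 2))
    (by fun_prop) (by simp), ae_chiSqSeq_pos] with η hne hpos
  rwa [limitRatio, ne_eq, div_eq_iff (hpos (i + 1)).ne']

theorem ae_injective_limitRatio : ∀ᵐ η ∂chiSqSeq, Function.Injective (limitRatio η) := by
  have h (i d : ℕ) : ∀ᵐ η ∂chiSqSeq, limitRatio η i ≠ limitRatio η (i + d + 1) := by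
    filter_upwards [ae_infinitePi_apply_ne chiSq (i + 1)
      (f := fun η => limitRatio η (i + d + 1) * η (i + 2))
      ((measurable_limitRatio _).mul (measurable_pi_apply _))
      (fun η x => by
        simp [limitRatio, Function.update_of_ne (show i + d + 1 + 1 ≠ i + 1 by omega),
          Function.update_of_ne (show i + d + 1 + 2 ≠ i + 1 by omega)]), ae_chiSqSeq_pos]
      with η hne hpos
    rwa [limitRatio, ne_eq, div_eq_iff (hpos (i + 1)).ne']
  filter_upwards [ae_all_iff.2 fun i => ae_all_iff.2 (h i)] with η hη
  refine .of_lt_imp_ne fun i j hij => ?_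
  obtain ⟨d, rfl⟩ := Nat.exists_eq_add_of_lt hij
  exact hη i d

theorem measurableSet_forall_ge_lt_limitRatio (t : ℝ) (g : ℕ) :
    MeasurableSet {η | ∀ i ≥ g, t < limitRatio η i} := by
  simp only [Set.ofPred_forall]
  exact .iInter fun i => .iInter fun _ =>
    measurableSet_lt measurable_const (measurable_limitRatio i)

theorem forall_ge_lt_limitRatio_of_mem_Ioo {η : ℕ → ℝ} {M t : ℝ} {g m : ℕ} (hM : 0 < M)
    (ht0 : 0 < t) (ht1 : t < 1) (hinit : ∀ k ∈ Finset.Ioc g m, η k ∈ Set.Ioo M (M / t))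
    (hnext : η (m + 1) ∈ Set.Ioo 0 M) (htail : ∀ i ≥ m, t < limitRatio η i) :
    ∀ i ≥ g, t < limitRatio η i := by
  intro i hi
  obtain hm | hm := le_or_gt m i
  · exact htail i hm
  have hnum := (hinit (i + 1) (Finset.mem_Ioc.2 ⟨by omega, hm⟩)).1
  have hden : 0 < η (i + 2) ∧ t * η (i + 2) < M := by
    obtain rfl | hm := eq_or_lt_of_le (Nat.succ_le_of_lt hm)
    · exact ⟨hnext.1, by nlinarith [hnext.1, hnext.2]⟩
    · have h := hinit (i + 2) (Finset.mem_Ioc.2 ⟨by omega, hm⟩)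
      exact ⟨hM.trans h.1, (lt_div_iff₀' ht0).1 h.2⟩
  exact (lt_div_iff₀ hden.1).2 (hden.2.trans hnum)

theorem exists_chiSqSeq_tail_lt_limitRatio_pos {t : ℝ} (ht : t < 1) :
    ∃ m, ∃ M > 0, 0 < chiSqSeq {η | (∀ i ≥ m, t < limitRatio η i) ∧ η (m + 1) ∈ Set.Ioo 0 M} := by
  suffices h : ∃ q : ℕ × ℕ, 0 < chiSqSeq {η | (∀ i ≥ q.1, t < limitRatio η i) ∧
      η (q.1 + 1) ∈ Set.Ioo 0 (q.2 + 1 : ℝ)} from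
    let ⟨q, hq⟩ := h
    ⟨q.1, q.2 + 1, by positivity, hq⟩
  refine exists_measure_pos_of_not_measure_iUnion_null fun hnull => ?_
  obtain ⟨η, hη, hlim, hpos⟩ := ((measure_eq_zero_iff_ae_notMem.1 hnull).and
    (ae_tendsto_limitRatio.and ae_chiSqSeq_pos)).exists
  obtain ⟨d, hd⟩ := eventually_atTop.1 (hlim.eventually_const_lt ht)
  obtain ⟨l, hl⟩ := exists_nat_gt (η (d + 1))
  exact hη (Set.mem_iUnion.2 ⟨(d, l), hd, hpos _, hl.trans (by simp)⟩)

theorem chiSqSeq_forall_ge_lt_limitRatio_pos {t : ℝ} (ht0 : 0 < t) (ht1 : t < 1) (g : ℕ) :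
    0 < chiSqSeq {η | ∀ i ≥ g, t < limitRatio η i} := by
  obtain ⟨m, M, hM, htail⟩ := exists_chiSqSeq_tail_lt_limitRatio_pos ht1
  have hMt : M < M / t := (lt_div_iff₀ ht0).2 (by nlinarith)
  -- Resampling `η (g + 1), …, η m` in `(M, M / t)` makes every ratio before the tail large.
  let box : Set (Finset.Ioc g m → ℝ) := Set.univ.pi fun _ => Set.Ioo M (M / t)
  have hbox : 0 < Measure.infinitePi (fun i : Finset.Ioc g m => chiSq i) box := by
    rw [Measure.infinitePi_eq_pi, Measure.pi_pi]
    refine pos_iff_ne_zero.2 (Finset.prod_ne_zero_iff.2 fun i _ => ne_of_gt ?_)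
    have : NeZero (i : ℕ) := ⟨by have := Finset.mem_Ioc.1 i.2; omega⟩
    obtain ⟨x, hx⟩ := exists_between hMt
    exact chiSq_pos_of_isOpen isOpen_Ioo (hM.trans hx.1).le hx
  have hextend := measurePreserving_extend chiSq
    (Subtype.val_injective (p := (· ∈ Finset.Ioc g m)))
  calc 0 < Measure.infinitePi (fun i : Finset.Ioc g m => chiSq i) box * chiSqSeq _ :=
        ENNReal.mul_pos hbox.ne' htail.ne'
    _ = _ := (Measure.prod_prod _ _).symm
    _ ≤ _ := measure_mono ?_
    _ = chiSqSeq {η | ∀ i ≥ g, t < limitRatio η i} := hextend.measure_preimage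
        (measurableSet_forall_ge_lt_limitRatio t g).nullMeasurableSet
  rintro ⟨x, η⟩ ⟨hx, htail, hnext⟩ i hi
  have htail_eq (k : ℕ) (hk : m < k) :
      Function.extend (Subtype.val : Finset.Ioc g m → ℕ) x η k = η k :=
    Function.extend_apply' _ _ _ fun ⟨l, hl⟩ => (hl ▸ hk).not_ge (Finset.mem_Ioc.1 l.2).2
  dsimp only
  refine forall_ge_lt_limitRatio_of_mem_Ioo hM ht0 ht1
    (fun k hk => (Subtype.val_injective.extend_apply x η ⟨k, hk⟩).symm ▸ hx ⟨k, hk⟩ trivial)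
    ?_ (fun i hi => ?_) i hi
  · rw [htail_eq _ (Nat.lt_succ_self _)]
    exact hnext
  · dsimp only [limitRatio]
    rw [htail_eq _ (by omega), htail_eq _ (by omega)]
    exact htail i hi

theorem chiSqSeq_limitRatio_lt_pos {t : ℝ} (ht : 0 < t) (i : ℕ) :
    0 < chiSqSeq {η | limitRatio η i < t} := by
  let U (k : ℕ) : Set ℝ := if k = i + 1 then Set.Iio t else Set.Ioi 1
  have hrect : chiSqSeq ((({i + 1, i + 2} : Finset ℕ) : Set ℕ).pi U) =
      chiSq (i + 1) (Set.Iio t) * chiSq (i + 2) (Set.Ioi 1) := by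
    rw [chiSqSeq, Measure.infinitePi_pi, Finset.prod_pair (by omega)]
    · simp [U]
    · intro k _
      dsimp only [U]
      split_ifs
      exacts [measurableSet_Iio, measurableSet_Ioi]
  calc 0 < chiSq (i + 1) (Set.Iio t) * chiSq (i + 2) (Set.Ioi 1) :=
        ENNReal.mul_pos (chiSq_pos_of_isOpen isOpen_Iio le_rfl ht).ne'
          (chiSq_pos_of_isOpen isOpen_Ioi (x := 2) (by simp) (by simp)).ne'
    _ = _ := hrect.symm
    _ ≤ _ := measure_mono fun η hη => by
        have hnum : η (i + 1) < t := by simpa [U] using hη (i + 1) (by simp)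
        have hden : 1 < η (i + 2) := by simpa [U] using hη (i + 2) (by simp)
        have hpos : 0 < η (i + 2) := one_pos.trans hden
        exact (div_lt_iff₀ hpos).2 (by nlinarith)

theorem chiSqSeq_real_forall_ge_lt_limitRatio_mem_Ioo {t : ℝ} (ht : t ∈ Set.Ioo 0 1) (g : ℕ) :
    chiSqSeq.real {η | ∀ i ≥ g, t < limitRatio η i} ∈ Set.Ioo 0 1 := by
  refine ⟨ENNReal.toReal_pos (chiSqSeq_forall_ge_lt_limitRatio_pos ht.1 ht.2 g).ne'
    (measure_ne_top _ _), ?_⟩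
  have hcompl : 0 < chiSqSeq.real {η | ∀ i ≥ g, t < limitRatio η i}ᶜ :=
    ENNReal.toReal_pos (((chiSqSeq_limitRatio_lt_pos ht.1 g).trans_le
      (measure_mono fun η hη => Set.mem_compl fun h => (h g le_rfl).not_gt hη)).ne')
      (measure_ne_top _ _)
  rw [probReal_compl_eq_one_sub (measurableSet_forall_ge_lt_limitRatio t g)] at hcompl
  linarith

end LimitRatio

section RotationInvariance

variable {E : Type*} [NormedAddCommGroup E] [InnerProductSpace ℝ E] [FiniteDimensional ℝ E]
  [MeasurableSpace E] [BorelSpace E] {μ ν : Measure E}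

theorem charFun_eq_of_norm_eq (hμ : ∀ f : E ≃ₗᵢ[ℝ] E, μ.map f = μ) {x y : E} (h : ‖x‖ = ‖y‖) :
    charFun μ x = charFun μ y := by
  set f := (Submodule.span ℝ {x - y})ᗮ.reflection
  have hxy : f x = y := Submodule.reflection_sub h
  calc charFun μ x = charFun (μ.map f) y := by
        rw [charFun_apply, charFun_apply, integral_map (by fun_prop) (by fun_prop), ← hxy]
        simp
    _ = charFun μ y := by rw [hμ f]

theorem map_normalize_map_linearIsometryEquiv (hν : ∀ f : E ≃ₗᵢ[ℝ] E, ν.map f = ν)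
    (f : E ≃ₗᵢ[ℝ] E) :
    (ν.map fun y => ‖y‖⁻¹ • y).map f = ν.map fun y => ‖y‖⁻¹ • y := by
  conv_rhs => rw [← hν f]
  rw [Measure.map_map (by fun_prop) (by fun_prop), Measure.map_map (by fun_prop) (by fun_prop)]
  congr 1
  ext y
  simp

theorem charFun_map_normalize (t : E) : charFun (ν.map fun y => ‖y‖⁻¹ • y) t =
    ∫ y, Complex.exp (↑(‖y‖⁻¹ * inner ℝ y t) * Complex.I) ∂ν := by
  rw [charFun_apply, integral_map (by fun_prop) (by fun_prop)]
  simp only [real_inner_smul_left]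

theorem measurePreserving_norm_div_norm_smul [IsProbabilityMeasure μ] [IsProbabilityMeasure ν]
    (hμ : ∀ f : E ≃ₗᵢ[ℝ] E, μ.map f = μ) (hν : ∀ f : E ≃ₗᵢ[ℝ] E, ν.map f = ν)
    (hν0 : ν {0} = 0) :
    MeasurePreserving (fun q : E × E => (‖q.1‖ / ‖q.2‖) • q.2) (μ.prod ν) μ := by
  have hmeas : Measurable fun q : E × E => (‖q.1‖ / ‖q.2‖) • q.2 := by fun_prop
  refine ⟨hmeas, ?_⟩
  have : IsProbabilityMeasure ((μ.prod ν).map fun q : E × E => (‖q.1‖ / ‖q.2‖) • q.2) :=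
    Measure.isProbabilityMeasure_map hmeas.aemeasurable
  have hnorm := map_normalize_map_linearIsometryEquiv hν
  refine Measure.ext_of_charFun (funext fun t => ?_)
  -- Both `‖x‖ • t` and `‖t‖ • x` have norm `‖x‖ * ‖t‖`, which exchanges the roles of `x` and `t`.
  calc charFun ((μ.prod ν).map fun q : E × E => (‖q.1‖ / ‖q.2‖) • q.2) t
      = ∫ x, charFun (ν.map fun y => ‖y‖⁻¹ • y) (‖x‖ • t) ∂μ := by
        rw [charFun_apply, integral_map (by fun_prop) (by fun_prop), integral_prod]
        · refine integral_congr_ae (ae_of_all _ fun x => ?_)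
          simp only [charFun_map_normalize, real_inner_smul_left, real_inner_smul_right]
          congr! 5
          ring
        · refine .of_bound (by fun_prop) 1 (ae_of_all _ fun q => ?_)
          simp [Complex.norm_exp]
    _ = ∫ x, charFun (ν.map fun y => ‖y‖⁻¹ • y) (‖t‖ • x) ∂μ := by
        refine integral_congr_ae (ae_of_all _ fun x => charFun_eq_of_norm_eq hnorm ?_)
        simp [norm_smul, mul_comm]
    _ = ∫ y, charFun μ (‖t‖ • ‖y‖⁻¹ • y) ∂ν := by
        simp only [charFun_map_normalize]
        simp only [charFun_apply, real_inner_smul_right]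
        rw [integral_integral_swap]
        · congr! 7 with y x
          rw [real_inner_comm]
          ring
        · refine .of_bound (by fun_prop) 1 (ae_of_all _ fun q => ?_)
          simp [Function.uncurry, Complex.norm_exp]
    _ = ∫ _, charFun μ t ∂ν := by
        refine integral_congr_ae ?_
        filter_upwards [measure_eq_zero_iff_ae_notMem.1 hν0] with y hy
        refine charFun_eq_of_norm_eq hμ ?_
        have := norm_ne_zero_iff.2 hy
        simp [norm_smul, this]
    _ = charFun μ t := by simp

end RotationInvariance

section Coupling

variable {E : Type*} [NormedAddCommGroup E] [InnerProductSpace ℝ E] {p : ℕ}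

/-- The vectors with law `ν` of a point of the coupling. -/
def coupledVectors (q : (Fin p → E × E) × (ℕ → ℝ)) (j : Fin p) : E := (q.1 j).2

/-- The sequence obtained from the chi-squared sequence of a point of the coupling by replacing the
entries `n - j`, for `j < p`, where `n` is the dimension, by the squared Gram–Schmidt norms of the
vectors which have the lengths of the Gaussian vectors and the directions of `coupledVectors`. -/
noncomputable def coupledSeq (q : (Fin p → E × E) × (ℕ → ℝ)) : ℕ → ℝ :=
  Function.extend (fun j : Fin p => Module.finrank ℝ E - j)
    (gsNormSq fun j => (‖(q.1 j).1‖ / ‖(q.1 j).2‖) • coupledVectors q j) q.2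

theorem injective_const_sub_fin {n : ℕ} (hp : p ≤ n) :
    Function.Injective fun j : Fin p => n - (j : ℕ) :=
  fun i j h => Fin.ext (by simp only at h; omega)

theorem coupledSeq_finrank_sub (hp : p ≤ Module.finrank ℝ E) (q : (Fin p → E × E) × (ℕ → ℝ))
    (hq : ∀ j, (q.1 j).1 ≠ 0 ∧ (q.1 j).2 ≠ 0) (j : Fin p) :
    coupledSeq q (Module.finrank ℝ E - j) =
      ‖(q.1 j).1‖ ^ 2 / ‖(q.1 j).2‖ ^ 2 * gsNormSq (coupledVectors q) j := by
  have hscale (j : Fin p) : ‖(q.1 j).1‖ / ‖(q.1 j).2‖ ≠ 0 := by simp [hq j]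
  rw [coupledSeq, (injective_const_sub_fin hp).extend_apply,
    gsNormSq_smul (coupledVectors q) hscale, div_pow]

variable [FiniteDimensional ℝ E] [MeasurableSpace E] [BorelSpace E]

/-- The law of `p` independent pairs of independent vectors, a Gaussian one and one with law `ν`,
together with an independent sequence of chi-squared variables. -/
noncomputable def couplingMeasure (p : ℕ) (ν : Measure E) : Measure ((Fin p → E × E) × (ℕ → ℝ)) :=
  (Measure.pi fun _ => (stdGaussian E).prod ν).prod chiSqSeq

variable {ν : Measure E} [IsProbabilityMeasure ν]

instance : IsProbabilityMeasure (couplingMeasure p ν) :=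
  inferInstanceAs (IsProbabilityMeasure (Measure.prod _ _))

theorem measurePreserving_fst_apply_couplingMeasure (j : Fin p) :
    MeasurePreserving (fun q => q.1 j) (couplingMeasure p ν) ((stdGaussian E).prod ν) :=
  (measurePreserving_eval (fun _ => (stdGaussian E).prod ν) j).comp measurePreserving_fst

theorem measurePreserving_coupledVectors :
    MeasurePreserving coupledVectors (couplingMeasure p ν) (Measure.pi fun _ => ν) :=
  (measurePreserving_pi _ _ fun _ => measurePreserving_snd).comp measurePreserving_fst

theorem measurePreserving_coupledSeq (hν : ∀ f : E ≃ₗᵢ[ℝ] E, ν.map f = ν) (hν0 : ν {0} = 0)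
    (hp : p ≤ Module.finrank ℝ E) :
    MeasurePreserving coupledSeq (couplingMeasure p ν) chiSqSeq := by
  have hgauss := measurePreserving_pi (fun _ : Fin p => (stdGaussian E).prod ν)
    (fun _ => stdGaussian E) fun _ => measurePreserving_norm_div_norm_smul stdGaussian_map hν hν0
  have hextend := measurePreserving_extend chiSq (injective_const_sub_fin hp)
  rw [Measure.infinitePi_eq_pi] at hextend
  exact hextend.comp
    (((measurePreserving_gsNormSq_stdGaussian hp).comp hgauss).prod (.id chiSqSeq))

end Coupling

section Comparison

variable {n p : ℕ}

/-- The system `y` is linearly independent and its local ratios agree, up to a factor between `c`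
and `c⁻¹`, with the ratios of consecutive entries of `η`. -/
def RatiosComparable (c : ℝ) (y : Fin p → EuclideanSpace ℝ (Fin n)) (η : ℕ → ℝ) : Prop :=
  LinearIndependent ℝ y ∧ ∀ j : Fin (p - 1),
    c * limitRatio η (n - j - 2) ≤ localRatio y j ∧ c * localRatio y j ≤ limitRatio η (n - j - 2)

theorem localRatio_nonneg (y : Fin p → EuclideanSpace ℝ (Fin n)) (j : Fin (p - 1)) :
    0 ≤ localRatio y j := by
  unfold localRatio
  positivity

theorem ratiosComparable_of_eq_mul_gsNormSq {c : ℝ} {y : Fin p → EuclideanSpace ℝ (Fin n)}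
    {η : ℕ → ℝ} {r : Fin p → ℝ} (hp : p ≤ n) (hη : ∀ j : Fin p, η (n - j) = r j * gsNormSq y j)
    (hη0 : ∀ j : Fin p, η (n - j) ≠ 0) (hr0 : ∀ j, 0 < r j) (hr : ∀ i j, c * r i ≤ r j) :
    RatiosComparable c y η := by
  refine ⟨linearIndependent_iff_forall_gsNormSq_ne_zero.2 fun j =>
    right_ne_zero_of_mul (hη j ▸ hη0 j), fun j => ?_⟩
  let j₀ : Fin p := ⟨j, by omega⟩
  let j₁ : Fin p := ⟨j + 1, by omega⟩
  have hratio : limitRatio η (n - j - 2) = r j₁ / r j₀ * localRatio y j := by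
    have h₁ : n - j - 2 + 1 = n - j₁ := by simp only [j₁]; omega
    have h₀ : n - j - 2 + 2 = n - j₀ := by simp only [j₀]; omega
    rw [limitRatio, h₁, h₀, hη, hη, mul_div_mul_comm]
    rfl
  have hle : c * (r j₁ / r j₀) ≤ 1 := by
    rw [mul_div_assoc', div_le_one (hr0 _)]
    exact hr _ _
  have hge : c ≤ r j₁ / r j₀ := (le_div_iff₀ (hr0 _)).2 (hr _ _)
  rw [hratio, ← mul_assoc]
  exact ⟨mul_le_of_le_one_left (localRatio_nonneg y j) hle,
    mul_le_mul_of_nonneg_right hge (localRatio_nonneg y j)⟩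

theorem mul_div_le_div_of_abs_sub_one_lt {c ρ u u' v v' : ℝ} (hρ : ρ < 1)
    (hc : c * (1 + ρ) ^ 2 ≤ (1 - ρ) ^ 2) (hc0 : 0 < c) (hu : |u - 1| < ρ) (hu' : |u' - 1| < ρ)
    (hv : |v - 1| < ρ) (hv' : |v' - 1| < ρ) : c * (u / v) ≤ u' / v' := by
  rw [abs_sub_lt_iff] at hu hu' hv hv'
  rw [mul_div_assoc', div_le_div_iff₀ (by linarith) (by linarith)]
  have hρ0 : 0 < 1 + ρ := by linarith
  calc c * u * v' ≤ c * (1 + ρ) * (1 + ρ) := by gcongr <;> linarith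
    _ ≤ (1 - ρ) * (1 - ρ) := by linarith
    _ ≤ u' * v := by gcongr <;> linarith

theorem ratiosComparable_coupling {c ρ a b : ℝ}
    (hp : p ≤ n) (hρ : ρ < 1) (hc0 : 0 < c) (hc : c * (1 + ρ) ^ 2 ≤ (1 - ρ) ^ 2)
    {q : (Fin p → EuclideanSpace ℝ (Fin n) × EuclideanSpace ℝ (Fin n)) × (ℕ → ℝ)}
    (hq0 : ∀ j : Fin p, coupledSeq q (n - j) ≠ 0)
    (hx : ∀ j, |‖(q.1 j).1‖ ^ 2 / a - 1| < ρ) (hy : ∀ j, |‖(q.1 j).2‖ ^ 2 / b - 1| < ρ) :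
    RatiosComparable c (coupledVectors q) (coupledSeq q) := by
  have hpos {z d : ℝ} (h : |z ^ 2 / d - 1| < ρ) : 0 < d ∧ z ≠ 0 := by
    have h0 : 0 < z ^ 2 / d := by linarith [(abs_sub_lt_iff.1 h).2]
    have h1 := (div_pos_iff.1 h0).resolve_right fun h => h.1.not_ge (sq_nonneg z)
    exact ⟨h1.2, pow_ne_zero_iff two_ne_zero |>.1 h1.1.ne'⟩
  have hseq := coupledSeq_finrank_sub (q := q) (by simpa using hp)
    fun j => ⟨norm_ne_zero_iff.1 (hpos (hx j)).2, norm_ne_zero_iff.1 (hpos (hy j)).2⟩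
  rw [finrank_euclideanSpace_fin] at hseq
  refine ratiosComparable_of_eq_mul_gsNormSq hp hseq hq0 (fun j => ?_) fun i j => ?_
  · have hxj := (hpos (hx j)).2
    have hyj := (hpos (hy j)).2
    positivity
  · have h := mul_div_le_div_of_abs_sub_one_lt hρ hc hc0 (hx i) (hx j) (hy i) (hy j)
    rwa [div_div_div_comm _ a, div_div_div_comm _ a, mul_div_assoc',
      div_le_div_iff_of_pos_right (div_pos (hpos (hx i)).1 (hpos (hy i)).1)] at h

theorem measureReal_not_ratiosComparable_coupling_le {ν : Measure (EuclideanSpace ℝ (Fin n))}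
    [IsProbabilityMeasure ν]
    (hν : ∀ f : EuclideanSpace ℝ (Fin n) ≃ₗᵢ[ℝ] EuclideanSpace ℝ (Fin n), ν.map f = ν)
    (hν0 : ν {0} = 0) {c ρ : ℝ} (hp : p ≤ n) (hρ : ρ < 1) (hc0 : 0 < c)
    (hc : c * (1 + ρ) ^ 2 ≤ (1 - ρ) ^ 2) (a b : ℝ) :
    (couplingMeasure p ν).real {q | ¬RatiosComparable c (coupledVectors q) (coupledSeq q)} ≤
      p * ((stdGaussian (EuclideanSpace ℝ (Fin n))).real {x | ρ ≤ |‖x‖ ^ 2 / a - 1|} +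
        ν.real {y | ρ ≤ |‖y‖ ^ 2 / b - 1|}) := by
  let A : Set (EuclideanSpace ℝ (Fin n)) := {x | ρ ≤ |‖x‖ ^ 2 / a - 1|}
  let B : Set (EuclideanSpace ℝ (Fin n)) := {y | ρ ≤ |‖y‖ ^ 2 / b - 1|}
  have hA : MeasurableSet A := measurableSet_le (by fun_prop) (by fun_prop)
  have hB : MeasurableSet B := measurableSet_le (by fun_prop) (by fun_prop)
  let S : Set (EuclideanSpace ℝ (Fin n) × EuclideanSpace ℝ (Fin n)) :=
    Prod.fst ⁻¹' A ∪ Prod.snd ⁻¹' B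
  have hS : MeasurableSet S := (measurable_fst hA).union (measurable_snd hB)
  have hpair (j : Fin p) := measurePreserving_fst_apply_couplingMeasure (ν := ν) j
  have hbad : {q | ¬RatiosComparable c (coupledVectors q) (coupledSeq q)} ≤ᵐ[couplingMeasure p ν]
      ⋃ j, (fun q => q.1 j) ⁻¹' S := by
    have hpos := (measurePreserving_coupledSeq hν hν0 (p := p) (by simpa using hp)
      ).quasiMeasurePreserving.ae ae_chiSqSeq_pos
    filter_upwards [hpos] with q hq hnot
    by_contra hgood
    have hgood (j : Fin p) : (q.1 j).1 ∉ A ∧ (q.1 j).2 ∉ B :=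
      not_or.1 fun h => hgood (Set.mem_iUnion.2 ⟨j, h⟩)
    refine hnot (ratiosComparable_coupling hp hρ hc0 hc (fun j => ?_)
      (fun j => not_le.1 (hgood j).1) fun j => not_le.1 (hgood j).2)
    have hj : n - j - 1 + 1 = n - j := by omega
    exact hj ▸ (hq _).ne'
  calc _ ≤ (couplingMeasure p ν).real (⋃ j, (fun q => q.1 j) ⁻¹' S) :=
        ENNReal.toReal_mono (measure_ne_top _ _) (measure_mono_ae hbad)
    _ ≤ ∑ j, (couplingMeasure p ν).real ((fun q => q.1 j) ⁻¹' S) :=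
        measureReal_iUnion_fintype_le _
    _ ≤ ∑ _ : Fin p, ((stdGaussian _).real A + ν.real B) := Finset.sum_le_sum fun j _ => by
        rw [(hpair j).measureReal_preimage hS.nullMeasurableSet]
        refine (measureReal_union_le _ _).trans_eq ?_
        rw [measurePreserving_fst.measureReal_preimage hA.nullMeasurableSet,
          measurePreserving_snd.measureReal_preimage hB.nullMeasurableSet]
    _ = _ := by rw [Finset.sum_const, Finset.card_fin, nsmul_eq_mul]

end Comparison

section Stability

/-- With probability tending to one, `n` random vectors with law `ν n` have simultaneously a
squared norm asymptotic to a deterministic sequence. -/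
def SimultaneousRadialConcentration (ν : (n : ℕ) → Measure (EuclideanSpace ℝ (Fin n))) : Prop :=
  ∃ a : ℕ → ℝ, ∀ ρ > 0,
    Tendsto (fun n => n * (ν n).real {x | ρ ≤ |‖x‖ ^ 2 / a n - 1|}) atTop (𝓝 0)

theorem tendsto_natCast_mul_of_le_mul_pow {u : ℕ → ℝ} {C q : ℝ} (hq0 : 0 ≤ q) (hq1 : q < 1)
    (hu0 : ∀ n, 0 ≤ u n) (hu : ∀ n ≥ 1, u n ≤ C * q ^ n) :
    Tendsto (fun n : ℕ => n * u n) atTop (𝓝 0) := by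
  have hbound : Tendsto (fun n : ℕ => C * (n * q ^ n)) atTop (𝓝 0) := by
    simpa using (tendsto_self_mul_const_pow_of_lt_one hq0 hq1).const_mul C
  refine squeeze_zero' (.of_forall fun n => mul_nonneg n.cast_nonneg (hu0 n)) ?_ hbound
  filter_upwards [eventually_ge_atTop 1] with n hn
  calc n * u n ≤ n * (C * q ^ n) := by gcongr; exact hu n hn
    _ = C * (n * q ^ n) := by ring

theorem RadialConcentration.simultaneous {ν : (n : ℕ) → Measure (EuclideanSpace ℝ (Fin n))}
    (hprob : ∀ n ≥ 1, IsProbabilityMeasure (ν n)) (h : RadialConcentration ν) :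
    SimultaneousRadialConcentration ν := by
  obtain ⟨a, d₁, d₂, α, ρ₀, -, -, hd₂, -, hρ₀, h⟩ := h
  refine ⟨a, fun ρ hρ => ?_⟩
  obtain ⟨r, hr0, hr⟩ := exists_between (lt_min hρ hρ₀.1)
  have hrate : 0 < d₂ * r ^ α := mul_pos hd₂ (Real.rpow_pos_of_pos hr0 α)
  refine tendsto_natCast_mul_of_le_mul_pow (C := d₁) (Real.exp_pos (-(d₂ * r ^ α))).le
    (Real.exp_lt_one_iff.2 (neg_lt_zero.2 hrate)) (fun n => measureReal_nonneg) fun n hn => ?_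
  have := hprob n hn
  calc (ν n).real {x | ρ ≤ |‖x‖ ^ 2 / a n - 1|} ≤ (ν n).real {x | r ≤ |‖x‖ ^ 2 / a n - 1|} :=
        measureReal_mono fun x hx => (hr.le.trans (min_le_left _ _)).trans hx
    _ ≤ d₁ * Real.exp (-(n * d₂ * r ^ α)) := h n hn r ⟨hr0, hr.trans_le (min_le_right _ _)⟩
    _ = d₁ * Real.exp (-(d₂ * r ^ α)) ^ n := by
        rw [← Real.exp_nat_mul]
        ring_nf

theorem simultaneousRadialConcentration_stdGaussian :
    SimultaneousRadialConcentration fun n => stdGaussian (EuclideanSpace ℝ (Fin n)) := by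
  refine ⟨fun n => n, fun ρ hρ => ?_⟩
  obtain ⟨q, hq0, hq1, hq⟩ := exists_lt_one_forall_chiSq_measureReal_le hρ
  refine tendsto_natCast_mul_of_le_mul_pow (C := 2) hq0 hq1 (fun n => measureReal_nonneg)
    fun n hn => ?_
  have hn : (0 : ℝ) < n := Nat.cast_pos.2 hn
  have hset : {x : EuclideanSpace ℝ (Fin n) | ρ ≤ |‖x‖ ^ 2 / n - 1|} =
      (fun x => ‖x‖ ^ 2) ⁻¹' {x | n * ρ ≤ |x - n|} := by
    ext x
    rw [Set.mem_ofPred_eq, div_sub_one hn.ne', abs_div, Nat.abs_cast, le_div_iff₀' hn]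
    rfl
  rw [hset, ← map_measureReal_apply (by fun_prop) (measurableSet_le (by fun_prop) (by fun_prop)),
    map_norm_sq_stdGaussian, finrank_euclideanSpace_fin]
  exact hq n

variable {ν : (n : ℕ) → Measure (EuclideanSpace ℝ (Fin n))}

theorem tendsto_measureReal_not_ratiosComparable_coupling (hν : IsSphericalModel ν)
    (hconc : SimultaneousRadialConcentration ν) {p : ℕ → ℕ} (hp : ∀ n, p n ≤ n) {c : ℝ}
    (hc : c ∈ Set.Ioo 0 1) :
    Tendsto (fun n => (couplingMeasure (p n) (ν n)).real
      {q | ¬RatiosComparable c (coupledVectors q) (coupledSeq q)}) atTop (𝓝 0) := by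
  obtain ⟨a, ha⟩ := simultaneousRadialConcentration_stdGaussian
  obtain ⟨b, hb⟩ := hconc
  have hρ : 0 < (1 - c) / 4 := by linarith [hc.2]
  have hcρ : c * (1 + (1 - c) / 4) ^ 2 ≤ (1 - (1 - c) / 4) ^ 2 := by
    nlinarith [mul_nonneg (sq_nonneg (1 - c)) (show 0 ≤ 9 - c by linarith [hc.2])]
  have hbound := (ha _ hρ).add (hb _ hρ)
  rw [add_zero] at hbound
  refine squeeze_zero' (.of_forall fun n => measureReal_nonneg) ?_ hbound
  filter_upwards [eventually_ge_atTop 1] with n hn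
  have := hν.isProbabilityMeasure n hn
  refine (measureReal_not_ratiosComparable_coupling_le (ρ := (1 - c) / 4) (hν.map_rotation n hn)
    (hν.zero n hn) (hp n) (by linarith [hc.1]) hc.1 hcρ (a n) (b n)).trans ?_
  rw [← mul_add]
  exact mul_le_mul_of_nonneg_right (Nat.cast_le.2 (hp n)) (by positivity)

theorem abs_measureReal_pi_sub_chiSqSeq_le {n p : ℕ} {ν : Measure (EuclideanSpace ℝ (Fin n))}
    [IsProbabilityMeasure ν]
    (hν : ∀ f : EuclideanSpace ℝ (Fin n) ≃ₗᵢ[ℝ] EuclideanSpace ℝ (Fin n), ν.map f = ν)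
    (hν0 : ν {0} = 0) (hp : p ≤ n) {c : ℝ} {S : Set (Fin p → EuclideanSpace ℝ (Fin n))}
    {T B : Set (ℕ → ℝ)} (hS : MeasurableSet S) (hT : MeasurableSet T) (hB : MeasurableSet B)
    (hstable : ∀ y, ∀ η ∈ B, RatiosComparable c y η → (y ∈ S ↔ η ∈ T)) :
    |(Measure.pi fun _ => ν).real S - chiSqSeq.real T| ≤
      (couplingMeasure p ν).real {q | ¬RatiosComparable c (coupledVectors q) (coupledSeq q)} +
        chiSqSeq.real Bᶜ := by
  have hy := measurePreserving_coupledVectors (ν := ν) (p := p)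
  have hη := measurePreserving_coupledSeq hν hν0 (p := p) (by simpa using hp)
  rw [← hy.measureReal_preimage hS.nullMeasurableSet,
    ← hη.measureReal_preimage hT.nullMeasurableSet,
    ← hη.measureReal_preimage hB.compl.nullMeasurableSet]
  calc _ ≤ _ := abs_measureReal_sub_le_measureReal_symmDiff (hy.measurable hS).nullMeasurableSet
        (hη.measurable hT).nullMeasurableSet
    _ ≤ (couplingMeasure p ν).real
        ({q | ¬RatiosComparable c (coupledVectors q) (coupledSeq q)} ∪ coupledSeq ⁻¹' Bᶜ) := by
      refine measureReal_mono fun q hq => ?_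
      by_contra hgood
      obtain ⟨hcomp, hB⟩ := not_or.1 hgood
      have hiff := hstable _ _ (not_not.1 hB) (not_not.1 hcomp)
      exact hq.elim (fun h => h.2 (hiff.1 h.1)) fun h => h.2 (hiff.2 h.1)
    _ ≤ _ := measureReal_union_le _ _

theorem tendsto_measureReal_pi_of_stable (hν : IsSphericalModel ν)
    (hconc : SimultaneousRadialConcentration ν) {p : ℕ → ℕ} (hp : ∀ n, p n ≤ n)
    {S : (n : ℕ) → Set (Fin (p n) → EuclideanSpace ℝ (Fin n))} {T : Set (ℕ → ℝ)}
    {B : ℝ × ℕ → Set (ℕ → ℝ)} (hS : ∀ n, MeasurableSet (S n)) (hT : MeasurableSet T)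
    (hB : ∀ q, MeasurableSet (B q))
    (hBae : ∀ᵐ η ∂chiSqSeq, ∀ᶠ q in 𝓝[<] 1 ×ˢ atTop, η ∈ B q)
    (hstable : ∀ c ∈ Set.Ioo (0 : ℝ) 1, ∀ n, ∀ y, ∀ η ∈ B (c, n), RatiosComparable c y η →
      (y ∈ S n ↔ η ∈ T)) :
    Tendsto (fun n => (Measure.pi fun _ => ν n).real (S n)) atTop (𝓝 (chiSqSeq.real T)) := by
  have hBlim : Tendsto (fun q => chiSqSeq (B q)ᶜ) (𝓝[<] 1 ×ˢ atTop) (𝓝 0) := by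
    rw [← measure_empty (μ := chiSqSeq)]
    refine tendsto_measure_of_ae_tendsto_indicator_of_isFiniteMeasure _ .empty
      (fun q => (hB q).compl) ?_
    filter_upwards [hBae] with η hη
    filter_upwards [hη] with q hq
    simpa using hq
  refine Metric.tendsto_nhds.2 fun ε hε => ?_
  have hBsmall : ∀ᶠ q in 𝓝[<] 1 ×ˢ atTop, chiSqSeq.real (B q)ᶜ < ε / 2 :=
    ((ENNReal.tendsto_toReal ENNReal.zero_ne_top).comp hBlim).eventually_lt_const (half_pos hε)
  obtain ⟨c, hcB, hc⟩ := (hBsmall.curry.and (Ioo_mem_nhdsLT one_pos)).exists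
  filter_upwards [hcB, eventually_ge_atTop 1,
    (tendsto_measureReal_not_ratiosComparable_coupling hν hconc hp hc).eventually_lt_const
      (half_pos hε)] with n hnB hn hncomp
  have := hν.isProbabilityMeasure n hn
  calc _ ≤ _ := abs_measureReal_pi_sub_chiSqSeq_le (hν.map_rotation n hn) (hν.zero n hn) (hp n)
        (hS n) hT (hB (c, n)) (hstable c hc n)
    _ < ε := by linarith

end Stability

section Reducedness

theorem eventually_forall_lt_mul_of_tendsto_one {u : ℕ → ℝ} (hu : Tendsto u atTop (𝓝 1)) {v : ℝ}
    (hv : v < 1) {I : Set ℕ} (h : ∀ i ∈ I, v < u i) : ∀ᶠ c in 𝓝 1, ∀ i ∈ I, v < c * u i := by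
  obtain ⟨w, hvw, hw⟩ := exists_between hv
  obtain ⟨N, hN⟩ := eventually_atTop.1 (hu.eventually_const_lt hw)
  have hmul {r : ℝ} (hr : v < r) : ∀ᶠ c : ℝ in 𝓝 1, v < c * r :=
    (tendsto_id.mul_const r).eventually_const_lt (by simpa using hr)
  have hinit : ∀ᶠ c in 𝓝 1, ∀ i ∈ Finset.range N, i ∈ I → v < c * u i :=
    (Filter.eventually_all_finset _).2 fun i _ =>
      eventually_imp_distrib_left.2 fun hi => hmul (h i hi)
  filter_upwards [hinit, hmul hvw, lt_mem_nhds one_pos] with c hc hcw hc0 i hi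
  obtain hiN | hiN := lt_or_ge i N
  · exact hc i (Finset.mem_range.2 hiN) hi
  · exact hcw.trans (mul_lt_mul_of_pos_left (hN i hiN) hc0)

theorem measurable_localRatio {n p : ℕ} (j : Fin (p - 1)) :
    Measurable fun y : Fin p → EuclideanSpace ℝ (Fin n) => localRatio y j :=
  ((measurable_gramSchmidt _).norm.pow_const 2).div ((measurable_gramSchmidt _).norm.pow_const 2)

theorem measurableSet_isSiegelReduced {n p : ℕ} (s : ℝ) :
    MeasurableSet {y : Fin p → EuclideanSpace ℝ (Fin n) | IsSiegelReduced s y} := by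
  simp only [IsSiegelReduced, linearIndependent_iff_forall_gsNormSq_ne_zero, Set.ofPred_and,
    Set.ofPred_forall]
  exact (MeasurableSet.iInter fun i =>
      ((measurable_pi_apply i).comp measurable_gsNormSq (measurableSet_singleton 0)).compl).inter
    (.iInter fun j => measurableSet_lt measurable_const (measurable_localRatio j))

section Deterministic

variable {n g : ℕ} {c s : ℝ} {y : Fin (n - g) → EuclideanSpace ℝ (Fin n)} {η : ℕ → ℝ}

theorem RatiosComparable.isSiegelReduced (h : RatiosComparable c y η)
    (hη : ∀ i ≥ g, s ^ 2 < c * limitRatio η i) : IsSiegelReduced s y :=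
  ⟨h.1, fun j => (hη (n - j - 2) (by omega)).trans_le (h.2 j).1⟩

theorem RatiosComparable.not_isSiegelReduced (h : RatiosComparable c y η) (hc : 0 < c) {i : ℕ}
    (hgi : g ≤ i) (hin : i + 2 ≤ n) (hη : limitRatio η i < c * s ^ 2) : ¬IsSiegelReduced s y := by
  intro hred
  let j : Fin (n - g - 1) := ⟨n - i - 2, by omega⟩
  have hj : n - j - 2 = i := by simp only [j]; omega
  have hle := (h.2 j).2
  rw [hj] at hle
  exact (hred.2 j).not_ge (le_of_mul_le_mul_left (hle.trans hη.le) hc)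

end Deterministic

variable {ν : (n : ℕ) → Measure (EuclideanSpace ℝ (Fin n))}

theorem tendsto_pi_measureReal_isSiegelReduced_one (hν : IsSphericalModel ν)
    (hconc : SimultaneousRadialConcentration ν) {s : ℝ} (hs : s ^ 2 < 1) {g : ℕ → ℕ}
    (hg : Tendsto g atTop atTop) :
    Tendsto (fun n => (Measure.pi fun _ : Fin (n - g n) => ν n).real {y | IsSiegelReduced s y})
      atTop (𝓝 1) := by
  rw [← probReal_univ (μ := chiSqSeq)]
  refine tendsto_measureReal_pi_of_stable hν hconc (fun n => n.sub_le (g n))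
    (B := fun q => {η | ∀ i ≥ g q.2, s ^ 2 < q.1 * limitRatio η i})
    (fun n => measurableSet_isSiegelReduced s) .univ (fun q => ?_) ?_
    fun c _ n y η hη hy => iff_of_true (hy.isSiegelReduced hη) trivial
  · simp only [Set.ofPred_forall]
    exact .iInter fun i => .iInter fun _ =>
      measurableSet_lt measurable_const ((measurable_limitRatio i).const_mul _)
  · filter_upwards [ae_tendsto_limitRatio] with η hη
    obtain ⟨N, hN⟩ := eventually_atTop.1 (hη.eventually_const_lt hs)
    have hc := (eventually_forall_lt_mul_of_tendsto_one hη hs (I := Set.Ici N) hN).filter_mono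
      (nhdsWithin_le_nhds (s := Set.Iio 1))
    filter_upwards [hc.prod_mk (hg.eventually_ge_atTop N)] with q hq i hi
    exact hq.1 i (hq.2.trans hi)

theorem tendsto_pi_measureReal_isSiegelReduced (hν : IsSphericalModel ν)
    (hconc : SimultaneousRadialConcentration ν) {s : ℝ} (hs : s ^ 2 < 1) (g : ℕ) :
    Tendsto (fun n => (Measure.pi fun _ : Fin (n - g) => ν n).real {y | IsSiegelReduced s y})
      atTop (𝓝 (chiSqSeq.real {η | ∀ i ≥ g, s ^ 2 < limitRatio η i})) := by
  refine tendsto_measureReal_pi_of_stable hν hconc (fun n => n.sub_le g)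
    (B := fun q => {η | (∀ i ≥ g, s ^ 2 < q.1 * limitRatio η i) ∨
      ∃ i ≥ g, i + 2 ≤ q.2 ∧ limitRatio η i < q.1 * s ^ 2})
    (fun n => measurableSet_isSiegelReduced s) (measurableSet_forall_ge_lt_limitRatio _ g)
    (fun q => ?_) ?_ fun c hc n y η hη hy => ?_
  · simp only [Set.ofPred_or, Set.ofPred_forall, Set.ofPred_exists, Set.ofPred_and]
    refine .union (.iInter fun i => .iInter fun _ => ?_)
      (.iUnion fun i => (MeasurableSet.const _).inter ((MeasurableSet.const _).inter ?_))
    · exact measurableSet_lt measurable_const ((measurable_limitRatio i).const_mul _)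
    · exact measurableSet_lt (measurable_limitRatio i) measurable_const
  · filter_upwards [ae_tendsto_limitRatio, ae_all_iff.2 fun i => ae_limitRatio_ne i (s ^ 2)]
      with η hlim hne
    by_cases hT : ∀ i ≥ g, s ^ 2 < limitRatio η i
    · have hc := (eventually_forall_lt_mul_of_tendsto_one hlim hs (I := Set.Ici g) hT).filter_mono
        (nhdsWithin_le_nhds (s := Set.Iio 1))
      filter_upwards [hc.prod_inl _] with q hq using .inl hq
    · push Not at hT
      obtain ⟨i, hi, hle⟩ := hT
      have hc : ∀ᶠ c : ℝ in 𝓝[<] 1, limitRatio η i < c * s ^ 2 :=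
        ((tendsto_id.mul_const (s ^ 2)).mono_left nhdsWithin_le_nhds).eventually_const_lt
          (by simpa using hle.lt_of_ne (hne i))
      filter_upwards [hc.prod_mk (eventually_ge_atTop (i + 2))] with q hq
      exact .inr ⟨i, hi, hq.2, hq.1⟩
  · obtain hη | ⟨i, hgi, hin, hη⟩ := hη
    · refine iff_of_true (hy.isSiegelReduced hη) fun i hi => (hη i hi).trans_le ?_
      have hpos := pos_of_mul_pos_right ((sq_nonneg s).trans_lt (hη i hi)) hc.1.le
      exact mul_le_of_le_one_left hpos.le hc.2.le
    · refine iff_of_false (hy.not_isSiegelReduced hc.1 hgi hin hη) fun hT => (hT i hgi).not_ge ?_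
      exact hη.le.trans (mul_le_of_le_one_left (sq_nonneg s) hc.2.le)

end Reducedness

section WorstIndex

/-- The position of the least entry, from the `g`-th one on, of the sequence of ratios
`limitRatio η`: the limit of `worstIndex` in codimension `g`. -/
noncomputable def limitWorstIndex (g : ℕ) (η : ℕ → ℝ) : ℕ :=
  sInf {k | g ≤ k ∧ ∀ i ≥ g, limitRatio η k ≤ limitRatio η i}

theorem limitWorstIndex_eq {g k : ℕ} {η : ℕ → ℝ} (hk : g ≤ k)
    (h : ∀ i ≥ g, i ≠ k → limitRatio η k < limitRatio η i) : limitWorstIndex g η = k := by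
  have hle (i : ℕ) (hi : i ≥ g) : limitRatio η k ≤ limitRatio η i := by
    obtain rfl | hik := eq_or_ne i k
    exacts [le_rfl, (h i hi hik).le]
  refine IsLeast.csInf_eq ⟨⟨hk, hle⟩, fun i hi => ?_⟩
  by_contra! hik
  exact (h i hi.1 hik.ne).not_ge (hi.2 k hk)

theorem worstIndex_eq {n p k : ℕ} {y : Fin p → EuclideanSpace ℝ (Fin n)} {j₀ : Fin (p - 1)}
    (hk : j₀ + k + 2 = n) (h : ∀ j ≠ j₀, localRatio y j₀ < localRatio y j) :
    worstIndex y = k := by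
  have hle (j : Fin (p - 1)) : localRatio y j₀ ≤ localRatio y j := by
    obtain rfl | hj := eq_or_ne j j₀
    exacts [le_rfl, (h j hj).le]
  have : Nonempty (Fin (p - 1)) := ⟨j₀⟩
  have hlevel : reductionLevel y = localRatio y j₀ :=
    le_antisymm (ciInf_le (Set.finite_range _).bddBelow j₀) (le_ciInf hle)
  refine IsLeast.csInf_eq ⟨⟨j₀, hk, hlevel.symm⟩, fun i ⟨j, hi, hj⟩ => ?_⟩
  obtain rfl : j = j₀ := by
    by_contra hne
    exact (h j hne).ne' (hj.trans hlevel)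
  omega

theorem measurable_sInf_nat {α : Type*} [MeasurableSpace α] {S : α → ℕ → Prop}
    (hS : ∀ k, MeasurableSet {a | S a k}) : Measurable fun a => sInf {k | S a k} := by
  refine measurable_of_Iic fun m => ?_
  have hset : (fun a => sInf {k | S a k}) ⁻¹' Set.Iic m =
      (⋃ k ≤ m, {a | S a k}) ∪ ⋂ k, {a | S a k}ᶜ := by
    ext a
    simp only [Set.mem_preimage, Set.mem_Iic, Set.mem_union, Set.mem_iUnion, Set.mem_iInter,
      Set.mem_compl_iff, Set.mem_ofPred_eq, exists_prop]
    refine ⟨fun h => ?_, ?_⟩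
    · by_cases hne : ∃ k, S a k
      · exact .inl ⟨_, h, Nat.sInf_mem hne⟩
      · exact .inr (not_exists.1 hne)
    · rintro (⟨k, hkm, hk⟩ | hempty)
      · exact (Nat.sInf_le hk).trans hkm
      · rw [Set.eq_empty_of_forall_notMem (s := {k | S a k}) hempty, Nat.sInf_empty]
        exact m.zero_le
  rw [hset]
  exact (MeasurableSet.iUnion fun k => .iUnion fun _ => hS k).union (.iInter fun k => (hS k).compl)

theorem measurable_worstIndex {n p : ℕ} :
    Measurable (worstIndex : (Fin p → EuclideanSpace ℝ (Fin n)) → ℕ) := by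
  refine measurable_sInf_nat fun i => ?_
  simp only [Set.ofPred_exists, Set.ofPred_and]
  exact .iUnion fun j => (MeasurableSet.const _).inter
    (measurableSet_eq_fun (measurable_localRatio j) (.iInf measurable_localRatio))

theorem measurable_limitWorstIndex (g : ℕ) : Measurable (limitWorstIndex g) := by
  refine measurable_sInf_nat fun k => ?_
  simp only [Set.ofPred_forall, Set.ofPred_and]
  exact (MeasurableSet.const _).inter (.iInter fun i => .iInter fun _ =>
    measurableSet_le (measurable_limitRatio k) (measurable_limitRatio i))

theorem ae_exists_ge_forall_limitRatio_lt (g : ℕ) : ∀ᵐ η ∂chiSqSeq,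
    ∃ k ≥ g, limitRatio η k < 1 ∧ ∀ i ≥ g, i ≠ k → limitRatio η k < limitRatio η i := by
  filter_upwards [ae_exists_ge_limitRatio_lt_one g, ae_tendsto_limitRatio, ae_injective_limitRatio]
    with η ⟨i₀, hi₀, hlt⟩ hlim hinj
  have hfin : {i | g ≤ i ∧ limitRatio η i ≤ limitRatio η i₀}.Finite := by
    have h := hlim.eventually_const_lt hlt
    rw [← Nat.cofinite_eq_atTop] at h
    exact h.subset fun i hi => hi.2.not_gt
  obtain ⟨k, hk, hmin⟩ := Set.exists_min_image _ (limitRatio η) hfin ⟨i₀, hi₀, le_rfl⟩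
  refine ⟨k, hk.1, hk.2.trans_lt hlt, fun i hi hik => lt_of_le_of_ne ?_ (hinj.ne hik.symm)⟩
  obtain h | h := le_total (limitRatio η i) (limitRatio η i₀)
  exacts [hmin i ⟨hi, h⟩, hk.2.trans h]

theorem RatiosComparable.worstIndex_eq_limitWorstIndex {n g k : ℕ} {c : ℝ}
    {y : Fin (n - g) → EuclideanSpace ℝ (Fin n)} {η : ℕ → ℝ} (h : RatiosComparable c y η)
    (hc : c ∈ Set.Ioo (0 : ℝ) 1) (hgk : g ≤ k) (hkn : k + 2 ≤ n)
    (hη : ∀ i ≥ g, i ≠ k → limitRatio η k < c ^ 2 * limitRatio η i) :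
    worstIndex y = limitWorstIndex g η := by
  let j₀ : Fin (n - g - 1) := ⟨n - k - 2, by omega⟩
  have hj₀ : n - j₀ - 2 = k := by simp only [j₀]; omega
  have hk := (h.2 j₀).2
  rw [hj₀] at hk
  have hworst : worstIndex y = k := by
    refine worstIndex_eq (j₀ := j₀) (by simp only [j₀]; omega) fun j hj => ?_
    have hjk : n - j - 2 ≠ k := fun hjk => hj (Fin.ext (by simp only [j₀]; omega))
    refine lt_of_mul_lt_mul_left ?_ hc.1.le
    calc c * localRatio y j₀ ≤ limitRatio η k := hk
      _ < c ^ 2 * limitRatio η (n - j - 2) := hη _ (by omega) hjk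
      _ = c * (c * limitRatio η (n - j - 2)) := by ring
      _ ≤ c * localRatio y j := mul_le_mul_of_nonneg_left (h.2 j).1 hc.1.le
  have hk0 : 0 ≤ limitRatio η k := (mul_nonneg hc.1.le (localRatio_nonneg y j₀)).trans hk
  have hlimit : limitWorstIndex g η = k := limitWorstIndex_eq hgk fun i hi hik => by
    have hi0 := pos_of_mul_pos_right (hk0.trans_lt (hη i hi hik)) (sq_nonneg c)
    exact (hη i hi hik).trans_le
      (mul_le_of_le_one_left hi0.le (pow_le_one₀ hc.1.le hc.2.le))
  rw [hworst, hlimit]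

variable {ν : (n : ℕ) → Measure (EuclideanSpace ℝ (Fin n))}

theorem tendsto_pi_measureReal_worstIndex_preimage (hν : IsSphericalModel ν)
    (hconc : SimultaneousRadialConcentration ν) (g : ℕ) (K : Set ℕ) :
    Tendsto (fun n => (Measure.pi fun _ : Fin (n - g) => ν n).real (worstIndex ⁻¹' K))
      atTop (𝓝 (chiSqSeq.real (limitWorstIndex g ⁻¹' K))) := by
  refine tendsto_measureReal_pi_of_stable hν hconc (fun n => n.sub_le g)
    (B := fun q => {η | ∃ k ≥ g, k + 2 ≤ q.2 ∧
      ∀ i ≥ g, i ≠ k → limitRatio η k < q.1 ^ 2 * limitRatio η i})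
    (fun n => measurable_worstIndex .of_discrete) (measurable_limitWorstIndex g .of_discrete)
    (fun q => ?_) ?_ fun c hc n y η ⟨k, hgk, hkn, hη⟩ hy => ?_
  · simp only [Set.ofPred_forall, Set.ofPred_exists, Set.ofPred_and]
    exact .iUnion fun k => (MeasurableSet.const _).inter ((MeasurableSet.const _).inter
      (.iInter fun i => .iInter fun _ => .iInter fun _ =>
        measurableSet_lt (measurable_limitRatio k) ((measurable_limitRatio i).const_mul _)))
  · filter_upwards [ae_exists_ge_forall_limitRatio_lt g, ae_tendsto_limitRatio]
      with η ⟨k, hgk, hk1, hk⟩ hlim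
    have hsq : Tendsto (fun c : ℝ => c ^ 2) (𝓝[<] 1) (𝓝 1) := by
      simpa using (tendsto_id.pow 2).mono_left (nhdsWithin_le_nhds (a := (1 : ℝ)))
    have hc := hsq.eventually (eventually_forall_lt_mul_of_tendsto_one hlim hk1
      (I := {i | i ≥ g ∧ i ≠ k}) fun i hi => hk i hi.1 hi.2)
    filter_upwards [hc.prod_mk (eventually_ge_atTop (k + 2))] with q hq
    exact ⟨k, hgk, hq.2, fun i hi hik => hq.1 i ⟨hi, hik⟩⟩
  · rw [Set.mem_preimage, Set.mem_preimage, hy.worstIndex_eq_limitWorstIndex hc hgk hkn hη]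

end WorstIndex

theorem IsRandomBasis.hasLaw_pi {n p : ℕ} {Ω : Type*} [MeasurableSpace Ω] {P : Measure Ω}
    {ν : Measure (EuclideanSpace ℝ (Fin n))} {b : Fin p → Ω → EuclideanSpace ℝ (Fin n)}
    (hb : IsRandomBasis P ν b) : HasLaw (fun ω i => b i ω) (Measure.pi fun _ => ν) P :=
  hb.indep.hasLaw_pi hb.hasLaw

theorem tendstoInDistribution_id_of_tendsto_measureReal {ι E : Type*} {Ω : ι → Type*}
    [∀ i, MeasurableSpace (Ω i)] {P : (i : ι) → Measure (Ω i)} [∀ i, IsProbabilityMeasure (P i)]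
    [TopologicalSpace E] [HasOuterApproxClosed E] [MeasurableSpace E] [OpensMeasurableSpace E]
    {X : (i : ι) → Ω i → E} {l : Filter ι} [l.IsCountablyGenerated] {μ : Measure E}
    [IsProbabilityMeasure μ] (hX : ∀ i, AEMeasurable (X i) (P i))
    (h : ∀ G, IsOpen G → Tendsto (fun i => (P i).real (X i ⁻¹' G)) l (𝓝 (μ.real G))) :
    TendstoInDistribution X l id P μ := by
  obtain rfl | _ := l.eq_or_neBot
  · exact ⟨hX, aemeasurable_id, tendsto_bot⟩
  refine ⟨hX, aemeasurable_id, tendsto_of_forall_isOpen_le_liminf' fun G hG => ?_⟩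
  have hlim : Tendsto (fun i => P i (X i ⁻¹' G)) l (𝓝 (μ G)) :=
    (ENNReal.tendsto_toReal_iff (fun i => measure_ne_top _ _) (measure_ne_top _ _)).1 (h G hG)
  simp only [ProbabilityMeasure.coe_mk, Measure.map_id,
    Measure.map_apply_of_aemeasurable (hX _) hG.measurableSet]
  exact hlim.liminf_eq.ge

/-- The limit law of `worstIndex` in codimension `g`. -/
noncomputable def worstIndexLaw (g : ℕ) : ProbabilityMeasure ℕ :=
  ⟨chiSqSeq.map (limitWorstIndex g),
    Measure.isProbabilityMeasure_map (measurable_limitWorstIndex g).aemeasurable⟩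

theorem tendstoInDistribution_worstIndex {ν : (n : ℕ) → Measure (EuclideanSpace ℝ (Fin n))}
    (hν : IsSphericalModel ν) (hconc : SimultaneousRadialConcentration ν) {g : ℕ}
    {Ω : ℕ → Type*} [∀ n, MeasurableSpace (Ω n)] {P : (n : ℕ) → Measure (Ω n)}
    [∀ n, IsProbabilityMeasure (P n)] {b : (n : ℕ) → Fin (n - g) → Ω n → EuclideanSpace ℝ (Fin n)}
    (hb : ∀ n, IsRandomBasis (P n) (ν n) (b n)) :
    TendstoInDistribution (fun n ω => worstIndex (fun i => b n i ω)) atTop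
      (id : ℕ → ℕ) P (worstIndexLaw g : Measure ℕ) := by
  refine tendstoInDistribution_id_of_tendsto_measureReal (fun n =>
    measurable_worstIndex.comp_aemeasurable (hb n).hasLaw_pi.aemeasurable) fun K _ => ?_
  have h := tendsto_pi_measureReal_worstIndex_preimage hν hconc g K
  rw [← map_measureReal_apply (measurable_limitWorstIndex g) .of_discrete] at h
  exact h.congr fun n => ((hb n).hasLaw_pi.measureReal_eq (measurable_worstIndex .of_discrete)).symm

theorem theorem1p4_general (s : ℝ) (hs : s ∈ Set.Ioo (0 : ℝ) 1) :
    (∀ (ν : (n : ℕ) → Measure (EuclideanSpace ℝ (Fin n))),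
      IsSphericalModel ν → SimultaneousRadialConcentration ν →
      ∀ g : ℕ → ℕ, (∀ n, g n ≤ n) → Tendsto g atTop atTop →
      ∀ (Ω : ℕ → Type u) [∀ n, MeasurableSpace (Ω n)] (P : (n : ℕ) → Measure (Ω n))
        [∀ n, IsProbabilityMeasure (P n)]
        (b : (n : ℕ) → Fin (n - g n) → Ω n → EuclideanSpace ℝ (Fin n)),
      (∀ n, IsRandomBasis (P n) (ν n) (b n)) →
      Tendsto (fun n => (P n).real {ω | IsSiegelReduced s (fun i => b n i ω)}) atTop (𝓝 1)) ∧
    (∀ g : ℕ, ∃ c ∈ Set.Ioo (0 : ℝ) 1,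
      ∀ (ν : (n : ℕ) → Measure (EuclideanSpace ℝ (Fin n))),
      IsSphericalModel ν → SimultaneousRadialConcentration ν →
      ∀ (Ω : ℕ → Type u) [∀ n, MeasurableSpace (Ω n)] (P : (n : ℕ) → Measure (Ω n))
        [∀ n, IsProbabilityMeasure (P n)]
        (b : (n : ℕ) → Fin (n - g) → Ω n → EuclideanSpace ℝ (Fin n)),
      (∀ n, IsRandomBasis (P n) (ν n) (b n)) →
      Tendsto (fun n => (P n).real {ω | IsSiegelReduced s (fun i => b n i ω)}) atTop (𝓝 c)) ∧
    (∀ g : ℕ, ∃ L : ProbabilityMeasure ℕ,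
      ∀ (ν : (n : ℕ) → Measure (EuclideanSpace ℝ (Fin n))),
      IsSphericalModel ν → SimultaneousRadialConcentration ν →
      ∀ (Ω : ℕ → Type u) [∀ n, MeasurableSpace (Ω n)] (P : (n : ℕ) → Measure (Ω n))
        [∀ n, IsProbabilityMeasure (P n)]
        (b : (n : ℕ) → Fin (n - g) → Ω n → EuclideanSpace ℝ (Fin n)),
      (∀ n, IsRandomBasis (P n) (ν n) (b n)) →
      TendstoInDistribution (fun n ω => worstIndex (fun i => b n i ω)) atTop
        (id : ℕ → ℕ) P (L : Measure ℕ)) := by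
  have hs2 : s ^ 2 ∈ Set.Ioo (0 : ℝ) 1 :=
    ⟨pow_pos hs.1 2, pow_lt_one₀ hs.1.le hs.2 two_ne_zero⟩
  refine ⟨fun ν hν hconc g _ hg Ω _ P _ b hb => ?_, fun g =>
    ⟨_, chiSqSeq_real_forall_ge_lt_limitRatio_mem_Ioo hs2 g, fun ν hν hconc Ω _ P _ b hb => ?_⟩,
    fun g => ⟨worstIndexLaw g, fun ν hν hconc Ω _ P _ b hb =>
      tendstoInDistribution_worstIndex hν hconc hb⟩⟩
  · refine (tendsto_pi_measureReal_isSiegelReduced_one hν hconc hs2.2 hg).congr fun n => ?_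
    exact ((hb n).hasLaw_pi.measureReal_eq (measurableSet_isSiegelReduced s)).symm
  · refine (tendsto_pi_measureReal_isSiegelReduced hν hconc hs2.2 g).congr fun n => ?_
    exact ((hb n).hasLaw_pi.measureReal_eq (measurableSet_isSiegelReduced s)).symm

theorem theorem1p4 (s : ℝ) (hs : s ∈ Set.Ioo (0 : ℝ) 1) :
    -- (i) codimension tending to infinity
    (∀ (ν : (n : ℕ) → Measure (EuclideanSpace ℝ (Fin n))),
      IsSphericalModel ν → RadialConcentration ν →
      ∀ g : ℕ → ℕ, (∀ n, g n ≤ n) → Tendsto g atTop atTop →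
      ∀ (Ω : ℕ → Type u) [∀ n, MeasurableSpace (Ω n)] (P : (n : ℕ) → Measure (Ω n))
        [∀ n, IsProbabilityMeasure (P n)]
        (b : (n : ℕ) → Fin (n - g n) → Ω n → EuclideanSpace ℝ (Fin n)),
      (∀ n, IsRandomBasis (P n) (ν n) (b n)) →
      Tendsto (fun n => (P n).real {ω | IsSiegelReduced s (fun i => b n i ω)}) atTop (𝓝 1)) ∧
    -- (ii) constant codimension: the limit depends only on `s` and `g`
    (∀ g : ℕ, ∃ c ∈ Set.Ioo (0 : ℝ) 1,
      ∀ (ν : (n : ℕ) → Measure (EuclideanSpace ℝ (Fin n))),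
      IsSphericalModel ν → RadialConcentration ν →
      ∀ (Ω : ℕ → Type u) [∀ n, MeasurableSpace (Ω n)] (P : (n : ℕ) → Measure (Ω n))
        [∀ n, IsProbabilityMeasure (P n)]
        (b : (n : ℕ) → Fin (n - g) → Ω n → EuclideanSpace ℝ (Fin n)),
      (∀ n, IsRandomBasis (P n) (ν n) (b n)) →
      Tendsto (fun n => (P n).real {ω | IsSiegelReduced s (fun i => b n i ω)}) atTop (𝓝 c)) ∧
    -- (iii) constant codimension: convergence in distribution of the index of worst local
    -- reduction to a probability law on `ℕ` which depends only on `g`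
    (∀ g : ℕ, ∃ L : ProbabilityMeasure ℕ,
      ∀ (ν : (n : ℕ) → Measure (EuclideanSpace ℝ (Fin n))),
      IsSphericalModel ν → RadialConcentration ν →
      ∀ (Ω : ℕ → Type u) [∀ n, MeasurableSpace (Ω n)] (P : (n : ℕ) → Measure (Ω n))
        [∀ n, IsProbabilityMeasure (P n)]
        (b : (n : ℕ) → Fin (n - g) → Ω n → EuclideanSpace ℝ (Fin n)),
      (∀ n, IsRandomBasis (P n) (ν n) (b n)) →
      TendstoInDistribution (fun n ω => worstIndex (fun i => b n i ω)) atTop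
        (id : ℕ → ℕ) P (L : Measure ℕ)) := by
  have hsim {ν} (hν : IsSphericalModel ν) :=
    RadialConcentration.simultaneous hν.isProbabilityMeasure
  have ⟨hone, hconst, hworst⟩ := theorem1p4_general.{u} s hs
  exact ⟨fun ν hν h => hone ν hν (hsim hν h),
    fun g => (hconst g).imp fun _ => .imp_right fun hlim ν hν h => hlim ν hν (hsim hν h),
    fun g => (hworst g).imp fun _ hlim ν hν h => hlim ν hν (hsim hν h)⟩
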